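/- Let $(M,g)$ be a compact connected smooth Riemannian manifold without boundary, of dimension $n>2$, with Ricci tensor $\operatorname{Ric}$ and scalar curvature $S$. Let $\xi$ be a smooth vector field on $M$, $\lambda:M\to\mathbb R$ a smooth function and $\rho\in\mathbb R$ a constant such that $(M,g,\xi,\lambda,\rho)$ is an almost Ricci–Bourguignon soliton (almost RB-soliton), that is, $$\operatorname{Ric}+\tfrac12\,\mathcal L_\xi g=(\lambda+\rho S)\,g .$$ Then $(M,g,\xi,\lambda,\rho)$ is a trivial RB-soliton, that is, $\lambda$ is constant and $\xi$ is a Killing field ($\mathcal L_\xi g=0$), if and only if the function $n(\lambda+\rho S)-S$ is constant along every integral curve of $\xi$. -/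

import Mathlib

open Bundle Manifold FiberBundle
open scoped ContDiff

namespace RBSoliton

noncomputable section

/- `M` is a manifold modelled on the finite-dimensional real vector space `E` (hence without boundary,
and of dimension `n = finrank ℝ E`), and `RiemannianBundle` puts an inner product `g` on each of its
tangent spaces. Its smooth dependence on the base point (`IsContMDiffRiemannianBundle`) is required
in the statements about these notions. -/
variable {E : Type*} [NormedAddCommGroup E] [NormedSpace ℝ E] [FiniteDimensional ℝ E]
  {M : Type*} [TopologicalSpace M] [ChartedSpace E M]
  [IsManifold 𝓘(ℝ, E) ∞ M] [RiemannianBundle (fun x : M ↦ TangentSpace 𝓘(ℝ, E) x)]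

instance instFiniteDimensionalTangent (x : M) : FiniteDimensional ℝ (TangentSpace 𝓘(ℝ, E) x) :=
  inferInstanceAs (FiniteDimensional ℝ E)

/-- An orthonormal basis `e₁, …, eₙ` of the tangent space at `x`. -/
def orthoBasis (x : M) : OrthonormalBasis (Fin (Module.finrank ℝ E)) ℝ (TangentSpace 𝓘(ℝ, E) x) :=
  (stdOrthonormalBasis ℝ (TangentSpace 𝓘(ℝ, E) x)).reindex (finCongr rfl)

/-- A vector field, smooth near `x`, which extends the tangent vector `v` at `x`. The tensors below
are evaluated on tangent vectors by extending these to vector fields. -/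
def extField {x : M} (v : TangentSpace 𝓘(ℝ, E) x) : Π y : M, TangentSpace 𝓘(ℝ, E) y :=
  extend E v

/-- The function `g(X, Y)`. -/
def metric (X Y : Π x : M, TangentSpace 𝓘(ℝ, E) x) (x : M) : ℝ := inner ℝ (X x) (Y x)

/-- The right-hand side of the Koszul formula: the value of `g(∇_X Y, Z)` at `x`. -/
def koszul (X Y Z : Π x : M, TangentSpace 𝓘(ℝ, E) x) (x : M) : ℝ :=
  (1 / 2) *
    (mvfderiv 𝓘(ℝ, E) (metric Y Z) x (X x) + mvfderiv 𝓘(ℝ, E) (metric Z X) x (Y x)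
      - mvfderiv 𝓘(ℝ, E) (metric X Y) x (Z x)
      + metric (VectorField.mlieBracket 𝓘(ℝ, E) X Y) Z x
      - metric (VectorField.mlieBracket 𝓘(ℝ, E) X Z) Y x
      - metric (VectorField.mlieBracket 𝓘(ℝ, E) Y Z) X x)

/-- The Levi-Civita connection `∇_X Y = ∑ᵢ g(∇_X Y, eᵢ) eᵢ`, through the Koszul formula. -/
def leviCivita (X Y : Π x : M, TangentSpace 𝓘(ℝ, E) x) (x : M) : TangentSpace 𝓘(ℝ, E) x :=
  ∑ i, koszul X Y (extField (orthoBasis x i)) x • orthoBasis x i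

/-- The curvature tensor `R(X, Y)Z = ∇_X ∇_Y Z - ∇_Y ∇_X Z - ∇_{[X, Y]} Z`. -/
def curvature (X Y Z : Π x : M, TangentSpace 𝓘(ℝ, E) x) (x : M) : TangentSpace 𝓘(ℝ, E) x :=
  leviCivita X (leviCivita Y Z) x - leviCivita Y (leviCivita X Z) x
    - leviCivita (VectorField.mlieBracket 𝓘(ℝ, E) X Y) Z x

/-- The Ricci tensor `Ric(u, v) = ∑ᵢ g(R(eᵢ, u)v, eᵢ)`. -/
def ricci (x : M) (u v : TangentSpace 𝓘(ℝ, E) x) : ℝ :=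
  ∑ i, inner ℝ (curvature (extField (orthoBasis x i)) (extField u) (extField v) x) (orthoBasis x i)

variable (E) in
/-- The scalar curvature `S`, the trace of the Ricci tensor. -/
def scalarCurvature (x : M) : ℝ :=
  ∑ i, ricci (E := E) x (orthoBasis x i) (orthoBasis x i)

/-- The Lie derivative `(£_ξ g)(u, v) = ξ(g(U, V)) - g([ξ, U], V) - g(U, [ξ, V])` of the metric,
where `U`, `V` extend `u`, `v`. -/
def lieMetric (ξ : Π x : M, TangentSpace 𝓘(ℝ, E) x) (x : M) (u v : TangentSpace 𝓘(ℝ, E) x) : ℝ :=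
  mvfderiv 𝓘(ℝ, E) (metric (extField u) (extField v)) x (ξ x)
    - metric (VectorField.mlieBracket 𝓘(ℝ, E) ξ (extField u)) (extField v) x
    - metric (extField u) (VectorField.mlieBracket 𝓘(ℝ, E) ξ (extField v)) x

/-- `(M, g, ξ, lam, ρ)` is an almost Ricci-Bourguignon soliton: `ξ` is a smooth vector field, `lam` a
smooth function, and `Ric + ½ £_ξ g = (lam + ρ S) g`. -/
structure IsAlmostRBSoliton (ξ : Π x : M, TangentSpace 𝓘(ℝ, E) x) (lam : M → ℝ) (ρ : ℝ) : Prop where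
  smooth_field : ContMDiff 𝓘(ℝ, E) 𝓘(ℝ, E).tangent ∞
    (fun x ↦ (⟨x, ξ x⟩ : TangentBundle 𝓘(ℝ, E) M))
  smooth_function : ContMDiff 𝓘(ℝ, E) 𝓘(ℝ) ∞ lam
  soliton_eq : ∀ (x : M) (u v : TangentSpace 𝓘(ℝ, E) x),
    ricci x u v + (1 / 2) * lieMetric ξ x u v = (lam x + ρ * scalarCurvature E x) * inner ℝ u v

/-- `ξ` is a Killing field: `£_ξ g = 0`. -/
def IsKilling (ξ : Π x : M, TangentSpace 𝓘(ℝ, E) x) : Prop :=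
  ∀ (x : M) (u v : TangentSpace 𝓘(ℝ, E) x), lieMetric ξ x u v = 0

/-- A trivial RB-soliton: an almost RB-soliton with constant soliton function and Killing potential
field. -/
structure IsTrivialRBSoliton (ξ : Π x : M, TangentSpace 𝓘(ℝ, E) x) (lam : M → ℝ) (ρ : ℝ) : Prop
    extends IsAlmostRBSoliton ξ lam ρ where
  constant : ∃ c : ℝ, ∀ x, lam x = c
  killing : IsKilling ξ

/-- `f` is constant along every integral curve of `ξ`, defined on any bounded open interval. (Curves on
larger intervals are covered by restriction.) -/
def IsConstantAlongIntegralCurves (ξ : Π x : M, TangentSpace 𝓘(ℝ, E) x) (f : M → ℝ) : Prop :=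
  ∀ (γ : ℝ → M) (a b : ℝ), IsMIntegralCurveOn γ ξ (Set.Ioo a b) →
    ∀ s ∈ Set.Ioo a b, ∀ t ∈ Set.Ioo a b, f (γ s) = f (γ t)

end

end RBSoliton

/-! The trace of the soliton equation is div ξ = n(λ + ρS) − S (`divergence_eq`), so the function in
the statement is the divergence of ξ. A Killing field has zero divergence, which settles one
direction.

Conversely, suppose ξ(div ξ) = 0. Then div((div ξ) ξ) = (div ξ)², and because divergences integrate
to zero on a closed manifold, div ξ = 0. Write Q for the Ricci operator and c = λ + ρS, so that now
S = nc. The contracted Bianchi identity gives div(Qξ) = ½ ξ(S) + tr(Q ∘ ∇ξ) (`localDiv_ricciOp`). By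
the soliton equation ∇ξ − (c − Q) is skew, hence tr(Q ∘ ∇ξ) = cS − tr Q². Together these give div(½
S ξ − Qξ) = tr Q² − cS = |Q − c|² ≥ 0 (`localDiv_einstein`). Integrating once more, Q = c; the
soliton equation then leaves £_ξ g = 0. As n > 2, Schur's lemma makes S constant on the connected
manifold, and c = S/n makes λ constant.

Integration enters only through `divergence_eq_zero_of_nonneg`: a nonnegative divergence vanishes. A
partition of unity and the chart densities √det g suffice for this, with neither an orientation nor
a global measure. The tensor identities are proved for a metric G on an open subset of E and carried
to M by the lemmas ending in `_param`. -/

namespace RBSoliton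

/-! ### Christoffel symbols and curvature of a metric on an open subset of a vector space. -/

noncomputable section LocalGeometry

set_option maxSynthPendingDepth 3

open scoped Topology

variable {E : Type*} [NormedAddCommGroup E] [NormedSpace ℝ E]
  {F : Type*} [NormedAddCommGroup F] [NormedSpace ℝ F]

/-- Cyclic rotation of the arguments of a trilinear map. -/
def rot : (E →L[ℝ] E →L[ℝ] E →L[ℝ] F) →L[ℝ] (E →L[ℝ] E →L[ℝ] E →L[ℝ] F) :=
  (ContinuousLinearMap.compL ℝ E (E →L[ℝ] E →L[ℝ] F) (E →L[ℝ] E →L[ℝ] F)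
    (ContinuousLinearMap.flipₗᵢ ℝ E E F).toContinuousLinearEquiv.toContinuousLinearMap).comp
  (ContinuousLinearMap.flipₗᵢ ℝ E E (E →L[ℝ] F)).toContinuousLinearEquiv.toContinuousLinearMap

@[simp] lemma rot_apply (T : E →L[ℝ] E →L[ℝ] E →L[ℝ] F) (u v w : E) : rot T u v w = T w u v := rfl

/-- Exchange of the arguments of a bilinear map. -/
def swap {H : Type*} [NormedAddCommGroup H] [NormedSpace ℝ H] :
    (E →L[ℝ] H →L[ℝ] F) →L[ℝ] (H →L[ℝ] E →L[ℝ] F) :=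
  (ContinuousLinearMap.flipₗᵢ ℝ E H F).toContinuousLinearEquiv.toContinuousLinearMap

@[simp] lemma swap_apply {H : Type*} [NormedAddCommGroup H] [NormedSpace ℝ H]
    (T : E →L[ℝ] H →L[ℝ] F) (u : H) (v : E) : swap T u v = T v u := rfl

lemma contDiffOn_swap {H K : Type*} [NormedAddCommGroup H] [NormedSpace ℝ H]
    [NormedAddCommGroup K] [NormedSpace ℝ K] {n : ℕ∞ω} {f : K → E →L[ℝ] H →L[ℝ] F} {s : Set K}
    (hf : ContDiffOn ℝ n f s) : ContDiffOn ℝ n (fun y ↦ swap (f y)) s :=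
  (swap (E := E) (H := H) (F := F)).contDiff.comp_contDiffOn hf

lemma fderiv_clm_apply₂ {F : Type*} [NormedAddCommGroup F] [NormedSpace ℝ F]
    {T : E → E →L[ℝ] E →L[ℝ] F} {a b : E → E} {y : E} (hT : DifferentiableAt ℝ T y)
    (ha : DifferentiableAt ℝ a y) (hb : DifferentiableAt ℝ b y) (u : E) :
    fderiv ℝ (fun z ↦ T z (a z) (b z)) y u
      = fderiv ℝ T y u (a y) (b y) + T y (fderiv ℝ a y u) (b y) + T y (a y) (fderiv ℝ b y u) := by
  have h1 := ((hT.hasFDerivAt.clm_apply ha.hasFDerivAt).clm_apply hb.hasFDerivAt)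
  rw [h1.fderiv]
  simp
  abel

section Trace

variable [FiniteDimensional ℝ E]

/-- The trace, as a continuous linear functional on endomorphisms. -/
def tr : (E →L[ℝ] E) →L[ℝ] ℝ :=
  LinearMap.toContinuousLinearMap
    ((LinearMap.trace ℝ E).comp (ContinuousLinearMap.coeLM ℝ : (E →L[ℝ] E) →ₗ[ℝ] (E →ₗ[ℝ] E)))

lemma tr_apply (A : E →L[ℝ] E) : tr A = LinearMap.trace ℝ E (A : E →ₗ[ℝ] E) := rfl

lemma tr_comp_comm (A B : E →L[ℝ] E) : tr (A ∘L B) = tr (B ∘L A) := by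
  simp only [tr_apply]
  exact LinearMap.trace_mul_comm ℝ (A : E →ₗ[ℝ] E) (B : E →ₗ[ℝ] E)

lemma tr_id : tr (ContinuousLinearMap.id ℝ E) = Module.finrank ℝ E := by
  simp [tr_apply]

end Trace

/-- A smooth Riemannian metric on an open subset of a vector space. -/
structure IsLocalMetric (G : E → E →L[ℝ] E →L[ℝ] ℝ) (U : Set E) : Prop where
  isOpen : IsOpen U
  smooth : ContDiffOn ℝ ∞ G U
  symm : ∀ y ∈ U, ∀ u v, G y u v = G y v u
  pos : ∀ y ∈ U, ∀ v, v ≠ 0 → 0 < G y v v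

/-- The Christoffel symbols of the first kind. -/
def christoffelForm (G : E → E →L[ℝ] E →L[ℝ] ℝ) (y : E) : E →L[ℝ] E →L[ℝ] E →L[ℝ] ℝ :=
  (1 / 2 : ℝ) • (fderiv ℝ G y + swap (fderiv ℝ G y) - rot (fderiv ℝ G y))

/-- The Christoffel symbols of the second kind. -/
def christoffel (G : E → E →L[ℝ] E →L[ℝ] ℝ) (y : E) : E →L[ℝ] E →L[ℝ] E :=
  (ContinuousLinearMap.compL ℝ E (E →L[ℝ] ℝ) E (G y).inverse) ∘L christoffelForm G y

/-- The bilinear map `(u, v) ↦ Γ u ∘ Γ v`. -/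
def compSelf (Γ : E →L[ℝ] E →L[ℝ] E) : E →L[ℝ] E →L[ℝ] (E →L[ℝ] E) :=
  swap ((swap ((ContinuousLinearMap.compL ℝ E E E).comp Γ)).comp Γ)

@[simp] lemma compSelf_apply (Γ : E →L[ℝ] E →L[ℝ] E) (u v : E) :
    compSelf Γ u v = Γ u ∘L Γ v := rfl

/-- The curvature tensor in coordinates. -/
def localCurvature (G : E → E →L[ℝ] E →L[ℝ] ℝ) (y : E) : E →L[ℝ] E →L[ℝ] E →L[ℝ] E :=
  fderiv ℝ (christoffel G) y - swap (fderiv ℝ (christoffel G) y)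
    + (compSelf (christoffel G y) - swap (compSelf (christoffel G y)))

/-- The covariant derivative of a vector field in coordinates. -/
def covDeriv (G : E → E →L[ℝ] E →L[ℝ] ℝ) (Y : E → E) (y : E) : E →L[ℝ] E :=
  fderiv ℝ Y y + (christoffel G y).flip (Y y)

lemma covDeriv_apply (G : E → E →L[ℝ] E →L[ℝ] ℝ) (Y : E → E) (y u : E) :
    covDeriv G Y y u = fderiv ℝ Y y u + christoffel G y u (Y y) := rfl

lemma localCurvature_apply (G : E → E →L[ℝ] E →L[ℝ] ℝ) (y u v : E) :
    localCurvature G y u v = fderiv ℝ (christoffel G) y u v - fderiv ℝ (christoffel G) y v u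
      + (christoffel G y u ∘L christoffel G y v - christoffel G y v ∘L christoffel G y u) := rfl

lemma localCurvature_swap (G : E → E →L[ℝ] E →L[ℝ] ℝ) (y u v : E) :
    localCurvature G y u v = - localCurvature G y v u := by
  rw [localCurvature_apply, localCurvature_apply]; abel

/-- The Lie derivative of the metric in coordinates. -/
def localLie (G : E → E →L[ℝ] E →L[ℝ] ℝ) (X : E → E) (y u v : E) : ℝ :=
  fderiv ℝ G y (X y) u v + G y (fderiv ℝ X y u) v + G y u (fderiv ℝ X y v)

namespace IsLocalMetric

variable {G : E → E →L[ℝ] E →L[ℝ] ℝ} {U : Set E} {y : E}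

section Basic

lemma mem_nhds (hG : IsLocalMetric G U) (hy : y ∈ U) : U ∈ 𝓝 y := hG.isOpen.mem_nhds hy

lemma contDiffAt (hG : IsLocalMetric G U) (hy : y ∈ U) : ContDiffAt ℝ ∞ G y :=
  hG.smooth.contDiffAt (hG.mem_nhds hy)

lemma differentiableAt (hG : IsLocalMetric G U) (hy : y ∈ U) : DifferentiableAt ℝ G y :=
  (hG.contDiffAt hy).differentiableAt (by simp)

lemma contDiffOn_fderiv {H : Type*} [NormedAddCommGroup H] [NormedSpace ℝ H]
    {f : E → H} (hU : IsOpen U) (hf : ContDiffOn ℝ ∞ f U) : ContDiffOn ℝ ∞ (fderiv ℝ f) U :=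
  hf.fderiv_of_isOpen hU (by simp)

lemma fderiv_symm (hG : IsLocalMetric G U) (hy : y ∈ U) (u v w : E) :
    fderiv ℝ G y u v w = fderiv ℝ G y u w v := by
  have h1 : (fun z ↦ G z v w) =ᶠ[𝓝 y] (fun z ↦ G z w v) := by
    filter_upwards [hG.mem_nhds hy] with z hz using hG.symm z hz v w
  have h2 := congrArg (fun A : E →L[ℝ] ℝ ↦ A u) h1.fderiv_eq
  have hd := hG.differentiableAt hy
  have e (a b : E) : fderiv ℝ (fun z ↦ G z a b) y u = fderiv ℝ G y u a b := by
    rw [fderiv_clm_apply₂ (a := fun _ ↦ a) (b := fun _ ↦ b) hd (by fun_prop) (by fun_prop)]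
    simp
  simpa [e] using h2

lemma christoffelForm_apply (hG : IsLocalMetric G U) (hy : y ∈ U) (u v w : E) :
    christoffelForm G y u v w
      = (1 / 2) * (fderiv ℝ G y u v w + fderiv ℝ G y v w u - fderiv ℝ G y w u v) := by
  rw [hG.fderiv_symm hy v w u]
  rfl

variable [FiniteDimensional ℝ E]

lemma isInvertible (hG : IsLocalMetric G U) (hy : y ∈ U) : (G y).IsInvertible := by
  have hinj : Function.Injective (G y) := by
    rw [injective_iff_map_eq_zero]
    intro v hv
    by_contra hne
    have := hG.pos y hy v hne
    simp [hv] at this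
  have hdim : Module.finrank ℝ E = Module.finrank ℝ (E →L[ℝ] ℝ) := by
    rw [← (LinearMap.toContinuousLinearMap (𝕜 := ℝ) (E := E) (F' := ℝ)).finrank_eq]
    exact (Subspace.dual_finrank_eq (K := ℝ) (V := E)).symm
  let e := LinearEquiv.ofInjectiveOfFinrankEq (G y : E →ₗ[ℝ] (E →L[ℝ] ℝ)) hinj hdim
  exact ⟨e.toContinuousLinearEquiv, by ext v w; rfl⟩

lemma apply_inverse (hG : IsLocalMetric G U) (hy : y ∈ U) (φ : E →L[ℝ] ℝ) :
    G y ((G y).inverse φ) = φ := by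
  obtain ⟨e, he⟩ := hG.isInvertible hy
  rw [← he, ContinuousLinearMap.inverse_equiv]
  simp

omit [FiniteDimensional ℝ E] in
lemma nondegenerate (hG : IsLocalMetric G U) (hy : y ∈ U) {u v : E}
    (h : ∀ w, G y u w = G y v w) : u = v := by
  by_contra hne
  have := hG.pos y hy (u - v) (sub_ne_zero.2 hne)
  simp [h] at this

/-- Characterizes Γ by nondegeneracy of G. Symmetry of Γ and compatibility with G are read off from
it without touching the inverse metric. -/
lemma christoffel_pairing (hG : IsLocalMetric G U) (hy : y ∈ U) (u v w : E) :
    G y (christoffel G y u v) w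
      = (1 / 2) * (fderiv ℝ G y u v w + fderiv ℝ G y v w u - fderiv ℝ G y w u v) := by
  rw [← hG.christoffelForm_apply hy]
  exact congrArg (fun φ : E →L[ℝ] ℝ ↦ φ w) (hG.apply_inverse hy (christoffelForm G y u v))

lemma christoffel_comm (hG : IsLocalMetric G U) (hy : y ∈ U) (u v : E) :
    christoffel G y u v = christoffel G y v u := by
  apply hG.nondegenerate hy
  intro w
  rw [hG.christoffel_pairing hy, hG.christoffel_pairing hy, hG.fderiv_symm hy u v w,
    hG.fderiv_symm hy v w u, hG.fderiv_symm hy w u v]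
  ring

/-- This is ∇g = 0: in the two Christoffel expressions the derivatives of G along a and b cancel. -/
lemma compatible (hG : IsLocalMetric G U) (hy : y ∈ U) (u a b : E) :
    fderiv ℝ G y u a b = G y (christoffel G y u a) b + G y a (christoffel G y u b) := by
  rw [hG.symm y hy a, hG.christoffel_pairing hy, hG.christoffel_pairing hy,
    hG.fderiv_symm hy b a u, hG.fderiv_symm hy a u b, hG.fderiv_symm hy u b a]
  ring

lemma contDiffOn_inverse (hG : IsLocalMetric G U) :
    ContDiffOn ℝ ∞ (fun y ↦ (G y).inverse) U := by
  intro y hy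
  obtain ⟨e, he⟩ := hG.isInvertible hy
  have := contDiffAt_map_inverse (𝕜 := ℝ) (n := ∞) e
  rw [he] at this
  exact (this.comp y (hG.contDiffAt hy)).contDiffWithinAt

lemma contDiffOn_christoffel (hG : IsLocalMetric G U) : ContDiffOn ℝ ∞ (christoffel G) U := by
  have h0 := contDiffOn_fderiv hG.isOpen hG.smooth
  have h1 : ContDiffOn ℝ ∞ (christoffelForm G) U :=
    ((h0.add ((contDiffOn_swap h0))).sub
      (rot.contDiff.comp_contDiffOn h0)).const_smul (1 / 2 : ℝ)
  exact ((ContinuousLinearMap.compL ℝ E (E →L[ℝ] ℝ) E).contDiff.comp_contDiffOn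
    hG.contDiffOn_inverse).clm_comp h1

omit [FiniteDimensional ℝ E] in
lemma contDiffOn_compSelf {Γ : E → E →L[ℝ] E →L[ℝ] E} (h0 : ContDiffOn ℝ ∞ Γ U) :
    ContDiffOn ℝ ∞ (fun y ↦ compSelf (Γ y)) U := by
  have h3 : ContDiffOn ℝ ∞ (fun y ↦ (ContinuousLinearMap.compL ℝ E E E).comp (Γ y)) U :=
    contDiffOn_const.clm_comp h0
  have h4 : ContDiffOn ℝ ∞ (fun y ↦ swap ((ContinuousLinearMap.compL ℝ E E E).comp (Γ y))) U :=
    (contDiffOn_swap h3)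
  exact contDiffOn_swap (h4.clm_comp h0)

lemma contDiffOn_localCurvature (hG : IsLocalMetric G U) :
    ContDiffOn ℝ ∞ (localCurvature G) U := by
  have h0 := hG.contDiffOn_christoffel
  have h1 := contDiffOn_fderiv hG.isOpen h0
  have h2 := contDiffOn_compSelf h0
  have h3 : ContDiffOn ℝ ∞ (fun y ↦ swap (fderiv ℝ (christoffel G) y)) U :=
    (contDiffOn_swap h1)
  have h4 : ContDiffOn ℝ ∞ (fun y ↦ swap (compSelf (christoffel G y))) U :=
    (contDiffOn_swap h2)
  exact (h1.sub h3).add (h2.sub h4)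

end Basic

end IsLocalMetric

end LocalGeometry

end RBSoliton

/-! ### Symmetries of the curvature tensor and the second Bianchi identity. -/

namespace RBSoliton

noncomputable section LocalIdentities

set_option maxSynthPendingDepth 3

open scoped Topology

variable {E : Type*} [NormedAddCommGroup E] [NormedSpace ℝ E]

lemma fderiv_clm_const {F H : Type*} [NormedAddCommGroup F] [NormedSpace ℝ F]
    [NormedAddCommGroup H] [NormedSpace ℝ H]
    {T : E → H →L[ℝ] F} {y : E} (hT : DifferentiableAt ℝ T y) (a : H) (u : E) :
    fderiv ℝ (fun z ↦ T z a) y u = fderiv ℝ T y u a := by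
  have h1 := hT.hasFDerivAt.clm_apply (hasFDerivAt_const a y)
  rw [h1.fderiv]
  simp

lemma fderiv_clm_const₂ {F H K : Type*} [NormedAddCommGroup F] [NormedSpace ℝ F]
    [NormedAddCommGroup H] [NormedSpace ℝ H] [NormedAddCommGroup K] [NormedSpace ℝ K]
    {T : E → H →L[ℝ] K →L[ℝ] F} {y : E} (hT : DifferentiableAt ℝ T y) (a : H) (b : K) (u : E) :
    fderiv ℝ (fun z ↦ T z a b) y u = fderiv ℝ T y u a b := by
  rw [fderiv_clm_const (T := fun z ↦ T z a) (hT.clm_apply (differentiableAt_const a)),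
    fderiv_clm_const hT]

lemma fderiv_comp_clm {H : Type*} [NormedAddCommGroup H] [NormedSpace ℝ H]
    {A : E → E →L[ℝ] H} {B : E → E →L[ℝ] E} {y : E} (hA : DifferentiableAt ℝ A y)
    (hB : DifferentiableAt ℝ B y) (u : E) :
    fderiv ℝ (fun z ↦ A z ∘L B z) y u = fderiv ℝ A y u ∘L B y + A y ∘L fderiv ℝ B y u := by
  rw [(hA.hasFDerivAt.clm_comp hB.hasFDerivAt).fderiv]
  ext v
  simp [add_comm]

/-- The covariant derivative of the curvature tensor in coordinates. -/
def covCurvature (G : E → E →L[ℝ] E →L[ℝ] ℝ) (y w u v : E) : E →L[ℝ] E :=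
  fderiv ℝ (localCurvature G) y w u v
    + (christoffel G y w ∘L localCurvature G y u v - localCurvature G y u v ∘L christoffel G y w)
    - localCurvature G y (christoffel G y w u) v - localCurvature G y u (christoffel G y w v)

namespace IsLocalMetric

variable {G : E → E →L[ℝ] E →L[ℝ] ℝ} {U : Set E} {y : E} [FiniteDimensional ℝ E]

omit [FiniteDimensional ℝ E] in
lemma differentiableAt_of_contDiffOn {H : Type*} [NormedAddCommGroup H] [NormedSpace ℝ H]
    (hU : IsOpen U) (hy : y ∈ U) {f : E → H} (hf : ContDiffOn ℝ ∞ f U) : DifferentiableAt ℝ f y :=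
  (hf.contDiffAt (hU.mem_nhds hy)).differentiableAt (by simp)

lemma differentiableAt_christoffel (hG : IsLocalMetric G U) (hy : y ∈ U) :
    DifferentiableAt ℝ (christoffel G) y :=
  differentiableAt_of_contDiffOn hG.isOpen hy hG.contDiffOn_christoffel

lemma differentiableAt_fderiv_christoffel (hG : IsLocalMetric G U) (hy : y ∈ U) :
    DifferentiableAt ℝ (fderiv ℝ (christoffel G)) y :=
  differentiableAt_of_contDiffOn hG.isOpen hy (contDiffOn_fderiv hG.isOpen hG.contDiffOn_christoffel)

lemma differentiableAt_localCurvature (hG : IsLocalMetric G U) (hy : y ∈ U) :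
    DifferentiableAt ℝ (localCurvature G) y :=
  differentiableAt_of_contDiffOn hG.isOpen hy hG.contDiffOn_localCurvature

omit [FiniteDimensional ℝ E] in
lemma snd_fderiv_symm {H : Type*} [NormedAddCommGroup H] [NormedSpace ℝ H]
    (hU : IsOpen U) (hy : y ∈ U) {f : E → H} (hf : ContDiffOn ℝ ∞ f U) (u v : E) :
    fderiv ℝ (fderiv ℝ f) y u v = fderiv ℝ (fderiv ℝ f) y v u :=
  ((hf.contDiffAt (hU.mem_nhds hy)).isSymmSndFDerivAt
    (by simpa using (WithTop.coe_le_coe.2 le_top : ((2 : ℕ∞) : ℕ∞ω) ≤ ∞))).eq u v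

/-- Skew-symmetry of the curvature operators. -/
lemma localCurvature_skew (hG : IsLocalMetric G U) (hy : y ∈ U) (u v a b : E) :
    G y (localCurvature G y u v a) b = - G y a (localCurvature G y u v b) := by
  have hΓ := hG.differentiableAt_christoffel hy
  have hg := hG.differentiableAt hy
  have key (u v : E) : fderiv ℝ (fderiv ℝ G) y v u a b
      = fderiv ℝ G y v (christoffel G y u a) b + G y (fderiv ℝ (christoffel G) y v u a) b
        + (fderiv ℝ G y v a (christoffel G y u b)
          + G y a (fderiv ℝ (christoffel G) y v u b)) := by
    have h1 : (fun z ↦ fderiv ℝ G z u a b) =ᶠ[𝓝 y]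
        (fun z ↦ G z (christoffel G z u a) b + G z a (christoffel G z u b)) := by
      filter_upwards [hG.mem_nhds hy] with z hz using hG.compatible hz u a b
    have hD : DifferentiableAt ℝ (fderiv ℝ G) y :=
      differentiableAt_of_contDiffOn hG.isOpen hy (contDiffOn_fderiv hG.isOpen hG.smooth)
    have hc (a : E) : DifferentiableAt ℝ (fun z ↦ christoffel G z u a) y := by fun_prop
    have h2 := congrArg (fun A : E →L[ℝ] ℝ ↦ A v) h1.fderiv_eq
    rw [fderiv_fun_add (by fun_prop) (by fun_prop)] at h2
    simp only [add_apply] at h2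
    rw [fderiv_clm_apply₂ hg (hc a) (differentiableAt_const b),
      fderiv_clm_apply₂ hg (differentiableAt_const a) (hc b),
      fderiv_clm_const₂ hΓ, fderiv_clm_const₂ hΓ,
      fderiv_clm_const (T := fun z ↦ fderiv ℝ G z u a) (by fun_prop),
      fderiv_clm_const₂ hD] at h2
    simpa using h2
  -- `key` differentiates metric compatibility a second time. Second derivatives of G commute, so
  -- exchanging u and v and subtracting eliminates them; what remains is the skewness of R(u, v).
  have h1 := key u v
  have h2 := key v u
  rw [snd_fderiv_symm hG.isOpen hy hG.smooth] at h1
  simp only [hG.compatible hy] at h1 h2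
  simp only [localCurvature_apply, add_apply, sub_apply,
    ContinuousLinearMap.comp_apply, map_add, map_sub]
  linarith

lemma fderiv_localCurvature (hG : IsLocalMetric G U) (hy : y ∈ U) (w u v : E) :
    fderiv ℝ (localCurvature G) y w u v
      = fderiv ℝ (fderiv ℝ (christoffel G)) y w u v - fderiv ℝ (fderiv ℝ (christoffel G)) y w v u
        + ((fderiv ℝ (christoffel G) y w u ∘L christoffel G y v
            + christoffel G y u ∘L fderiv ℝ (christoffel G) y w v)
          - (fderiv ℝ (christoffel G) y w v ∘L christoffel G y u
            + christoffel G y v ∘L fderiv ℝ (christoffel G) y w u)) := by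
  have hΓ := hG.differentiableAt_christoffel hy
  have hD := hG.differentiableAt_fderiv_christoffel hy
  have hc (u : E) : DifferentiableAt ℝ (fun z ↦ christoffel G z u) y := by fun_prop
  have hd (u v : E) : DifferentiableAt ℝ (fun z ↦ fderiv ℝ (christoffel G) z u v) y := by fun_prop
  have hcc (u v : E) : DifferentiableAt ℝ (fun z ↦ christoffel G z u ∘L christoffel G z v) y :=
    (hc u).clm_comp (hc v)
  rw [← fderiv_clm_const₂ (hG.differentiableAt_localCurvature hy)]
  simp only [localCurvature_apply]
  rw [fderiv_fun_add ((hd u v).fun_sub (hd v u)) ((hcc u v).fun_sub (hcc v u)),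
    fderiv_fun_sub (hd u v) (hd v u), fderiv_fun_sub (hcc u v) (hcc v u)]
  simp only [add_apply, sub_apply]
  rw [fderiv_comp_clm (hc u) (hc v), fderiv_comp_clm (hc v) (hc u), fderiv_clm_const₂ hD,
    fderiv_clm_const₂ hD, fderiv_clm_const hΓ, fderiv_clm_const hΓ]

/-- The second Bianchi identity. -/
lemma bianchi (hG : IsLocalMetric G U) (hy : y ∈ U) (w u v : E) :
    covCurvature G y w u v + covCurvature G y u v w + covCurvature G y v w u = 0 := by
  -- In the cyclic sum the second derivatives of Γ cancel by symmetry, the correction terms R(Γ_w u,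
  -- v) cancel in pairs because Γ is symmetric, and the remaining terms are formal commutator
  -- cancellations.
  have hs := snd_fderiv_symm hG.isOpen hy hG.contDiffOn_christoffel
  simp only [covCurvature, hG.fderiv_localCurvature hy]
  rw [hs u v, hs w u, hs w v, localCurvature_swap G y u (christoffel G y w v),
    localCurvature_swap G y v (christoffel G y u w), localCurvature_swap G y w (christoffel G y v u),
    hG.christoffel_comm hy w v, hG.christoffel_comm hy u w, hG.christoffel_comm hy v u]
  simp only [localCurvature_apply]
  ext a
  simp only [add_apply, sub_apply, neg_apply,
    ContinuousLinearMap.comp_apply, map_add, map_sub, zero_apply]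
  abel

lemma covCurvature_swap (hG : IsLocalMetric G U) (hy : y ∈ U) (w u v : E) :
    covCurvature G y w u v = - covCurvature G y w v u := by
  simp only [covCurvature, hG.fderiv_localCurvature hy]
  rw [localCurvature_swap G y u v, localCurvature_swap G y u (christoffel G y w v),
    localCurvature_swap G y v (christoffel G y w u)]
  ext a
  simp only [add_apply, sub_apply, neg_apply, ContinuousLinearMap.comp_apply, map_neg]
  abel

/-- Skew-symmetry of the covariant derivatives of the curvature operators. -/
lemma covCurvature_skew (hG : IsLocalMetric G U) (hy : y ∈ U) (w u v a b : E) :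
    G y (covCurvature G y w u v a) b = - G y a (covCurvature G y w u v b) := by
  have hg := hG.differentiableAt hy
  have hR := hG.differentiableAt_localCurvature hy
  have hc (a : E) : DifferentiableAt ℝ (fun z ↦ localCurvature G z u v a) y := by fun_prop
  have hcf (a : E) : fderiv ℝ (fun z ↦ localCurvature G z u v a) y w
      = fderiv ℝ (localCurvature G) y w u v a := by
    rw [fderiv_clm_const (T := fun z ↦ localCurvature G z u v) (by fun_prop), fderiv_clm_const₂ hR]
  have h1 : (fun z ↦ G z (localCurvature G z u v a) b) =ᶠ[𝓝 y]
      (fun z ↦ - G z a (localCurvature G z u v b)) := by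
    filter_upwards [hG.mem_nhds hy] with z hz using hG.localCurvature_skew hz u v a b
  have h2 := congrArg (fun A : E →L[ℝ] ℝ ↦ A w) h1.fderiv_eq
  rw [fderiv_fun_neg] at h2
  simp only [neg_apply] at h2
  rw [fderiv_clm_apply₂ hg (hc a) (differentiableAt_const b),
    fderiv_clm_apply₂ hg (differentiableAt_const a) (hc b), hcf, hcf] at h2
  simp only [hG.compatible hy, fderiv_fun_const, Pi.zero_apply, zero_apply,
    map_zero, add_zero] at h2
  have s1 := hG.localCurvature_skew hy u v a (christoffel G y w b)
  have s2 := hG.localCurvature_skew hy u v (christoffel G y w a) b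
  have s3 := hG.localCurvature_skew hy (christoffel G y w u) v a b
  have s4 := hG.localCurvature_skew hy u (christoffel G y w v) a b
  simp only [covCurvature, add_apply, sub_apply, ContinuousLinearMap.comp_apply, map_add, map_sub]
  linarith

end IsLocalMetric

end LocalIdentities

end RBSoliton

/-! ### Ricci tensor, divergence and the contracted Bianchi identity. -/

namespace RBSoliton

noncomputable section LocalRicci

set_option maxSynthPendingDepth 3

open scoped Topology

variable {E : Type*} [NormedAddCommGroup E] [NormedSpace ℝ E] [FiniteDimensional ℝ E]

/-- The contraction `(u, v) ↦ tr (w ↦ T w u v)`. -/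
def contract : (E →L[ℝ] E →L[ℝ] E →L[ℝ] E) →L[ℝ] (E →L[ℝ] E →L[ℝ] ℝ) :=
  ((ContinuousLinearMap.compL ℝ E (E →L[ℝ] E →L[ℝ] E) (E →L[ℝ] ℝ))
    (ContinuousLinearMap.compL ℝ E (E →L[ℝ] E) ℝ tr)) ∘L rot

lemma contract_apply (T : E →L[ℝ] E →L[ℝ] E →L[ℝ] E) (u v : E) :
    contract T u v = tr (rot T u v) := rfl

/-- The Ricci tensor in coordinates. -/
def localRicci (G : E → E →L[ℝ] E →L[ℝ] ℝ) (y : E) : E →L[ℝ] E →L[ℝ] ℝ :=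
  contract (localCurvature G y)

/-- The Ricci operator in coordinates. -/
def ricciOp (G : E → E →L[ℝ] E →L[ℝ] ℝ) (y : E) : E →L[ℝ] E :=
  (G y).inverse ∘L localRicci G y

/-- The scalar curvature in coordinates. -/
def localScalar (G : E → E →L[ℝ] E →L[ℝ] ℝ) (y : E) : ℝ := tr (ricciOp G y)

/-- The divergence of a vector field in coordinates. -/
def localDiv (G : E → E →L[ℝ] E →L[ℝ] ℝ) (X : E → E) (y : E) : ℝ := tr (covDeriv G X y)

namespace IsLocalMetric

variable {G : E → E →L[ℝ] E →L[ℝ] ℝ} {U : Set E} {y : E}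

lemma contDiffOn_localRicci (hG : IsLocalMetric G U) : ContDiffOn ℝ ∞ (localRicci G) U :=
  (contract (E := E)).contDiff.comp_contDiffOn hG.contDiffOn_localCurvature

lemma contDiffOn_ricciOp (hG : IsLocalMetric G U) : ContDiffOn ℝ ∞ (ricciOp G) U :=
  hG.contDiffOn_inverse.clm_comp hG.contDiffOn_localRicci

lemma contDiffOn_localScalar (hG : IsLocalMetric G U) : ContDiffOn ℝ ∞ (localScalar G) U :=
  (tr (E := E)).contDiff.comp_contDiffOn hG.contDiffOn_ricciOp

lemma ricciOp_pairing (hG : IsLocalMetric G U) (hy : y ∈ U) (u v : E) :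
    G y (ricciOp G y u) v = localRicci G y u v :=
  congrArg (fun φ : E →L[ℝ] ℝ ↦ φ v) (hG.apply_inverse hy (localRicci G y u))

lemma contDiffOn_covDeriv (hG : IsLocalMetric G U) {X : E → E} (hX : ContDiffOn ℝ ∞ X U) :
    ContDiffOn ℝ ∞ (covDeriv G X) U :=
  (contDiffOn_fderiv hG.isOpen hX).add
    ((contDiffOn_swap hG.contDiffOn_christoffel).clm_apply hX)

lemma contDiffOn_localDiv (hG : IsLocalMetric G U) {X : E → E} (hX : ContDiffOn ℝ ∞ X U) :
    ContDiffOn ℝ ∞ (localDiv G X) U :=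
  (tr (E := E)).contDiff.comp_contDiffOn (hG.contDiffOn_covDeriv hX)

lemma localLie_eq (hG : IsLocalMetric G U) (hy : y ∈ U) (X : E → E) (u v : E) :
    localLie G X y u v = G y (covDeriv G X y u) v + G y u (covDeriv G X y v) := by
  simp only [localLie, covDeriv_apply, hG.compatible hy, map_add, add_apply]
  rw [hG.christoffel_comm hy (X y) u, hG.christoffel_comm hy (X y) v]
  ring

section Frame

variable {ι : Type*} [Fintype ι] {e : ι → E}

/-- The hypothesis `he` is all that these lemmas use of the orthonormality of the frame e;
`tr_frame` supplies it on the manifold. -/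
lemma sum_localLie (hG : IsLocalMetric G U) (hy : y ∈ U)
    (he : ∀ A : E →L[ℝ] E, tr A = ∑ i, G y (A (e i)) (e i)) (X : E → E) :
    ∑ i, localLie G X y (e i) (e i) = 2 * localDiv G X y := by
  rw [localDiv, he, Finset.mul_sum]
  refine Finset.sum_congr rfl fun i _ ↦ ?_
  rw [hG.localLie_eq hy, hG.symm y hy (e i)]
  ring

/-- Covariant differentiation commutes with contraction: the extra terms form the commutator of Γ_w
with an endomorphism, whose trace is zero. -/
lemma fderiv_localRicci (hG : IsLocalMetric G U) (hy : y ∈ U)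
    (he : ∀ A : E →L[ℝ] E, tr A = ∑ i, G y (A (e i)) (e i)) (w u v : E) :
    fderiv ℝ (localRicci G) y w u v - localRicci G y (christoffel G y w u) v
        - localRicci G y u (christoffel G y w v)
      = ∑ i, G y (covCurvature G y w (e i) u v) (e i) := by
  have h1 : fderiv ℝ (localRicci G) y w = contract (fderiv ℝ (localCurvature G) y w) := by
    have := ((contract (E := E)).hasFDerivAt.comp y
      (hG.differentiableAt_localCurvature hy).hasFDerivAt).fderiv
    exact congrArg (fun A : E →L[ℝ] (E →L[ℝ] E →L[ℝ] ℝ) ↦ A w) this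
  let R := localCurvature G y
  let Γ := christoffel G y w
  let N : E →L[ℝ] E := rot (fderiv ℝ (localCurvature G) y w) u v
    + (Γ ∘L rot R u v - rot R u v ∘L Γ) - rot R (Γ u) v - rot R u (Γ v)
  have h2 (a : E) : covCurvature G y w a u v = N a := by
    simp only [covCurvature, N, add_apply, sub_apply, ContinuousLinearMap.comp_apply, rot_apply, R, Γ]
    abel
  simp only [h2]
  rw [← he N]
  simp only [N, map_add, map_sub, tr_comp_comm Γ, localRicci, h1, contract_apply, sub_self, add_zero]
  rfl

/-- Since ∇g = 0, raising an index commutes with ∇, so ∇Q is obtained from the covariant derivative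
of Ric. -/
lemma covRicciOp_pairing (hG : IsLocalMetric G U) (hy : y ∈ U)
    (he : ∀ A : E →L[ℝ] E, tr A = ∑ i, G y (A (e i)) (e i)) (w u v : E) :
    G y (fderiv ℝ (ricciOp G) y w u + christoffel G y w (ricciOp G y u)
        - ricciOp G y (christoffel G y w u)) v
      = ∑ i, G y (covCurvature G y w (e i) u v) (e i) := by
  rw [← hG.fderiv_localRicci hy he]
  have hQ := differentiableAt_of_contDiffOn hG.isOpen hy hG.contDiffOn_ricciOp
  have hR := differentiableAt_of_contDiffOn hG.isOpen hy hG.contDiffOn_localRicci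
  have h1 : (fun z ↦ G z (ricciOp G z u) v) =ᶠ[𝓝 y] (fun z ↦ localRicci G z u v) := by
    filter_upwards [hG.mem_nhds hy] with z hz using hG.ricciOp_pairing hz u v
  have h2 := congrArg (fun A : E →L[ℝ] ℝ ↦ A w) h1.fderiv_eq
  rw [fderiv_clm_apply₂ (hG.differentiableAt hy) (hQ.clm_apply (differentiableAt_const u))
    (differentiableAt_const v), fderiv_clm_const₂ hR, fderiv_clm_const hQ, hG.compatible hy] at h2
  simp only [fderiv_fun_const, Pi.zero_apply, zero_apply, map_zero, add_zero,
    hG.ricciOp_pairing hy] at h2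
  simp only [map_add, map_sub, add_apply, sub_apply, hG.ricciOp_pairing hy]
  linarith

/-- The contracted second Bianchi identity, in the form `div (Q X) = ½ X(S) + tr (Q ∘ ∇X)`, where
`Q` is the Ricci operator. -/
lemma localDiv_ricciOp (hG : IsLocalMetric G U) (hy : y ∈ U)
    (he : ∀ A : E →L[ℝ] E, tr A = ∑ i, G y (A (e i)) (e i)) {X : E → E}
    (hX : DifferentiableAt ℝ X y) :
    localDiv G (fun z ↦ ricciOp G z (X z)) y
      = (1 / 2) * fderiv ℝ (localScalar G) y (X y) + tr (ricciOp G y ∘L covDeriv G X y) := by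
  have hQ := differentiableAt_of_contDiffOn hG.isOpen hy hG.contDiffOn_ricciOp
  let T (w a b i : E) : ℝ := G y (covCurvature G y w i a b) i
  have hS (w : E) : fderiv ℝ (localScalar G) y w
      = ∑ j, ∑ i, G y (covCurvature G y w (e i) (e j) (e j)) (e i) := by
    have h1 : fderiv ℝ (localScalar G) y w = tr (fderiv ℝ (ricciOp G) y w) :=
      congrArg (fun A : E →L[ℝ] ℝ ↦ A w) ((tr (E := E)).hasFDerivAt.comp y hQ.hasFDerivAt).fderiv
    -- D is ∇_w Q, which differs from the plain derivative by a commutator of trace zero; hence w(S)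
    -- = tr(∇_w Q).
    let D : E →L[ℝ] E := fderiv ℝ (ricciOp G) y w
      + christoffel G y w ∘L ricciOp G y - ricciOp G y ∘L christoffel G y w
    have h2 : tr D = tr (fderiv ℝ (ricciOp G) y w) := by
      simp only [D, map_add, map_sub, tr_comp_comm (christoffel G y w)]
      ring
    rw [h1, ← h2, he]
    exact Finset.sum_congr rfl fun j _ ↦ hG.covRicciOp_pairing hy he w (e j) (e j)
  have hD : localDiv G (fun z ↦ ricciOp G z (X z)) y - tr (ricciOp G y ∘L covDeriv G X y)
      = ∑ j, ∑ i, G y (covCurvature G y (e j) (e i) (X y) (e j)) (e i) := by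
    rw [localDiv, ← map_sub, he]
    refine Finset.sum_congr rfl fun j _ ↦ ?_
    rw [← hG.covRicciOp_pairing hy he]
    congr 2
    simp only [covDeriv_apply, sub_apply, ContinuousLinearMap.comp_apply, map_add]
    rw [(hQ.hasFDerivAt.clm_apply hX.hasFDerivAt).fderiv]
    simp only [add_apply, ContinuousLinearMap.comp_apply, ContinuousLinearMap.flip_apply]
    abel
  have hB : fderiv ℝ (localScalar G) y (X y)
      = 2 * ∑ j, ∑ i, G y (covCurvature G y (e j) (e i) (X y) (e j)) (e i) := by
    rw [hS]
    -- The Bianchi identity for X, eᵢ, eⱼ. After summation its two right-hand terms are the same sum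
    -- with i and j exchanged, whence the factor 2.
    have h1 (i j : ι) : G y (covCurvature G y (X y) (e i) (e j) (e j)) (e i)
        = G y (covCurvature G y (e i) (e j) (X y) (e i)) (e j)
          + G y (covCurvature G y (e j) (e i) (X y) (e j)) (e i) := by
      have h := hG.bianchi hy (X y) (e i) (e j)
      rw [hG.covCurvature_swap hy (e j) (X y) (e i)] at h
      have h' := congrArg (fun A : E →L[ℝ] E ↦ G y (A (e j)) (e i)) h
      simp only [add_apply, neg_apply, map_add, map_neg, zero_apply, map_zero] at h'
      have s := hG.covCurvature_skew hy (e i) (e j) (X y) (e j) (e i)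
      rw [hG.symm y hy (e j)] at s
      linarith
    simp only [h1, Finset.sum_add_distrib]
    rw [Finset.sum_comm, two_mul]
  linarith

end Frame

end IsLocalMetric

end LocalRicci

end RBSoliton

/-! ### The Riemannian density and its logarithmic derivative. -/

namespace RBSoliton

noncomputable section LocalDensity

set_option maxSynthPendingDepth 3

open scoped Topology Matrix
open MeasureTheory

section Determinant

variable {ι : Type*} [Fintype ι] [DecidableEq ι]

lemma contDiff_det : ContDiff ℝ ∞ (fun m : ι → ι → ℝ ↦ (Matrix.of m).det) := by
  simp only [Matrix.det_apply, Matrix.of_apply]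
  fun_prop

/-- A version of Jacobi's formula with no inverse of m: the curve (1 + tN)ᵀ m (1 + tN) has velocity
h at t = 0, and its determinant is det m · det(1 + tN)². -/
lemma fderiv_det {m h : ι → ι → ℝ} {N : Matrix ι ι ℝ}
    (hN : Matrix.of h = Nᵀ * Matrix.of m + Matrix.of m * N) :
    fderiv ℝ (fun m : ι → ι → ℝ ↦ (Matrix.of m).det) m h = 2 * (Matrix.of m).det * N.trace := by
  -- The quadratic coefficient that makes the curve c factor as a congruence of m.
  let k : ι → ι → ℝ := Nᵀ * Matrix.of m * N
  let c : ℝ → ι → ι → ℝ := fun t ↦ m + t • h + t ^ 2 • k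
  have hc : HasDerivAt c h 0 := by
    have h1 : HasDerivAt (fun t : ℝ ↦ t ^ 2 • k) ((0 : ℝ) • k) 0 := by
      simpa using (hasDerivAt_pow 2 (0 : ℝ)).smul_const k
    have h2 := (((hasDerivAt_id (0 : ℝ)).smul_const h).const_add m).add h1
    simp only [one_smul, zero_smul, add_zero] at h2
    exact h2
  have hc0 : c 0 = m := by simp [c]
  have h1 : HasDerivAt (fun t ↦ (Matrix.of (c t)).det)
      (fderiv ℝ (fun m : ι → ι → ℝ ↦ (Matrix.of m).det) m h) 0 := by
    have hd := ((contDiff_det (ι := ι)).differentiable (by simp) (c 0)).hasFDerivAt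
    rw [hc0] at hd
    rw [← hc0] at hd
    have := hd.comp_hasDerivAt (0 : ℝ) hc
    rw [hc0] at this
    exact this
  have h2 (t : ℝ) : (Matrix.of (c t)).det = (Matrix.of m).det * (1 + t • N).det ^ 2 := by
    have : Matrix.of (c t) = (1 + t • N)ᵀ * Matrix.of m * (1 + t • N) := by
      have e : Matrix.of (c t) = Matrix.of m + t • Matrix.of h
        + t ^ 2 • (Nᵀ * Matrix.of m * N) := rfl
      rw [e, hN]
      simp only [Matrix.transpose_add, Matrix.transpose_one, Matrix.transpose_smul, add_mul, mul_add,
        one_mul, mul_one, Matrix.smul_mul, Matrix.mul_smul, smul_add, smul_smul, pow_two]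
      abel
    rw [this, Matrix.det_mul, Matrix.det_mul, Matrix.det_transpose]
    ring
  have h3 : HasDerivAt (fun t : ℝ ↦ (1 + t • N).det) N.trace 0 := by
    rw [funext fun t ↦ Matrix.det_one_add_smul t N]
    set p := Polynomial.divX (Polynomial.divX (1 + (Polynomial.X : Polynomial ℝ) • N.map Polynomial.C).det)
    have e1 := (((hasDerivAt_id (0 : ℝ)).const_mul N.trace).const_add 1).add
      ((p.hasDerivAt 0).mul (hasDerivAt_pow 2 (0 : ℝ)))
    convert! e1 using 1
    simp
  have h4 := ((h3.fun_pow 2).const_mul (Matrix.of m).det)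
  simp only [← h2] at h4
  rw [h1.unique h4]
  simp
  ring

end Determinant

variable {E : Type*} [NormedAddCommGroup E] [NormedSpace ℝ E] [FiniteDimensional ℝ E]

/-- The Gram matrix of a bilinear form in the reference basis. -/
def gram (B : E →L[ℝ] E →L[ℝ] ℝ) :
    Fin (Module.finrank ℝ E) → Fin (Module.finrank ℝ E) → ℝ :=
  fun i j ↦ B (Module.finBasis ℝ E i) (Module.finBasis ℝ E j)

/-- The determinant of a bilinear form in the reference basis. -/
def gramDet (B : E →L[ℝ] E →L[ℝ] ℝ) : ℝ := (Matrix.of (gram B)).det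

/-- The Riemannian density in the reference basis. -/
def density (G : E → E →L[ℝ] E →L[ℝ] ℝ) (y : E) : ℝ := √(gramDet (G y))

lemma contDiff_gram : ContDiff ℝ ∞ (gram (E := E)) := by
  rw [contDiff_pi]
  intro i
  rw [contDiff_pi]
  intro j
  exact (contDiff_id.clm_apply contDiff_const).clm_apply contDiff_const

lemma contDiff_gramDet : ContDiff ℝ ∞ (gramDet (E := E)) := contDiff_det.comp contDiff_gram

/-- The matrix of an endomorphism in the reference basis. -/
def endMatrix (A : E →L[ℝ] E) : Matrix (Fin (Module.finrank ℝ E)) (Fin (Module.finrank ℝ E)) ℝ :=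
  LinearMap.toMatrix (Module.finBasis ℝ E) (Module.finBasis ℝ E) (A : E →ₗ[ℝ] E)

lemma sum_endMatrix (A : E →L[ℝ] E) (j : Fin (Module.finrank ℝ E)) :
    ∑ k, endMatrix A k j • Module.finBasis ℝ E k = A (Module.finBasis ℝ E j) := by
  conv_rhs => rw [← (Module.finBasis ℝ E).sum_repr (A (Module.finBasis ℝ E j))]
  simp [endMatrix, LinearMap.toMatrix_apply]

lemma trace_endMatrix (A : E →L[ℝ] E) : (endMatrix A).trace = tr A := by
  rw [tr_apply, LinearMap.trace_eq_matrix_trace ℝ (Module.finBasis ℝ E)]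
  rfl

lemma gram_mul_endMatrix (B : E →L[ℝ] E →L[ℝ] ℝ) (A : E →L[ℝ] E)
    (i j : Fin (Module.finrank ℝ E)) :
    (Matrix.of (gram B) * endMatrix A) i j
      = B (Module.finBasis ℝ E i) (A (Module.finBasis ℝ E j)) := by
  rw [← sum_endMatrix A j]
  simp [Matrix.mul_apply, gram, mul_comm]

lemma endMatrix_transpose_mul_gram (B : E →L[ℝ] E →L[ℝ] ℝ) (A : E →L[ℝ] E)
    (i j : Fin (Module.finrank ℝ E)) :
    ((endMatrix A)ᵀ * Matrix.of (gram B)) i j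
      = B (A (Module.finBasis ℝ E i)) (Module.finBasis ℝ E j) := by
  rw [← sum_endMatrix A i]
  simp [Matrix.mul_apply, gram]

lemma gramDet_comp {B B' : E →L[ℝ] E →L[ℝ] ℝ} {A : E →L[ℝ] E}
    (h : ∀ u v, B' u v = B (A u) (A v)) : gramDet B' = A.det ^ 2 * gramDet B := by
  have h1 : Matrix.of (gram B') = (endMatrix A)ᵀ * Matrix.of (gram B) * endMatrix A := by
    ext i j
    simp only [gram, Matrix.of_apply, h, Matrix.mul_apply (N := endMatrix A),
      endMatrix_transpose_mul_gram]
    rw [← sum_endMatrix A j]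
    simp [mul_comm]
  have h2 : (endMatrix A).det = A.det := by
    rw [endMatrix, LinearMap.det_toMatrix]
  rw [gramDet, h1, Matrix.det_mul, Matrix.det_mul, Matrix.det_transpose, h2, gramDet]
  ring

lemma fderiv_gramDet {B H : E →L[ℝ] E →L[ℝ] ℝ} {A : E →L[ℝ] E}
    (h : ∀ u v, H u v = B (A u) v + B u (A v)) :
    fderiv ℝ gramDet B H = 2 * gramDet B * tr A := by
  have h1 : HasFDerivAt (gram (E := E)) (fderiv ℝ gram B) B :=
    ((contDiff_gram (E := E)).differentiable (by simp) B).hasFDerivAt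
  have hlin : IsLinearMap ℝ (gram (E := E)) := ⟨fun _ _ ↦ rfl, fun _ _ ↦ rfl⟩
  have h3 : fderiv ℝ gram B H = gram H := by
    let L := LinearMap.toContinuousLinearMap (hlin.mk' (gram (E := E)))
    have : HasFDerivAt (gram (E := E)) L B := L.hasFDerivAt
    rw [this.fderiv]
    rfl
  have h4 : fderiv ℝ gramDet B H
      = fderiv ℝ (fun m : Fin (Module.finrank ℝ E) → Fin (Module.finrank ℝ E) → ℝ ↦
          (Matrix.of m).det) (gram B) (gram H) := by
    have h2 := (contDiff_det (ι := Fin (Module.finrank ℝ E))).differentiable (by simp) (gram B)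
    rw [← h3]
    exact congrArg (fun L : (E →L[ℝ] E →L[ℝ] ℝ) →L[ℝ] ℝ ↦ L H)
      (h2.hasFDerivAt.comp B h1).fderiv
  rw [h4, fderiv_det (N := endMatrix A), trace_endMatrix]
  · rfl
  · ext i j
    rw [Matrix.add_apply, gram_mul_endMatrix, endMatrix_transpose_mul_gram]
    exact h _ _

lemma gramDet_pos {B : E →L[ℝ] E →L[ℝ] ℝ} (hs : ∀ u v, B u v = B v u)
    (hp : ∀ v, v ≠ 0 → 0 < B v v) : 0 < gramDet B := by
  refine Matrix.PosDef.det_pos (Matrix.PosDef.of_dotProduct_mulVec_pos ?_ ?_)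
  · ext i j
    simp [gram, hs]
  · intro x hx
    have h0 : (∑ i, x i • Module.finBasis ℝ E i) ≠ 0 := by
      intro h
      exact hx (funext (Fintype.linearIndependent_iff.1 (Module.finBasis ℝ E).linearIndependent x h))
    have h1 := hp _ h0
    simp only [map_sum, map_smul, sum_apply, smul_apply,
      smul_eq_mul] at h1
    simp only [dotProduct, Matrix.mulVec, gram, Matrix.of_apply, star_trivial]
    convert! h1 using 1
    refine Finset.sum_congr rfl fun i _ ↦ ?_
    congr 1
    simp [mul_comm, hs (Module.finBasis ℝ E i)]

namespace IsLocalMetric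

variable {G : E → E →L[ℝ] E →L[ℝ] ℝ} {U : Set E} {y : E}

lemma gramDet_pos (hG : IsLocalMetric G U) (hy : y ∈ U) : 0 < gramDet (G y) :=
  RBSoliton.gramDet_pos (hG.symm y hy) (hG.pos y hy)

lemma density_pos (hG : IsLocalMetric G U) (hy : y ∈ U) : 0 < density G y :=
  Real.sqrt_pos.2 (hG.gramDet_pos hy)

lemma contDiffOn_density (hG : IsLocalMetric G U) : ContDiffOn ℝ ∞ (density G) U :=
  (contDiff_gramDet.comp_contDiffOn hG.smooth).sqrt fun _ hy ↦ (hG.gramDet_pos hy).ne'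

/-- Metric compatibility presents the derivative of G along v in the form required by
`fderiv_gramDet`, with A = Γ_v; the square root halves the factor 2. -/
lemma fderiv_density (hG : IsLocalMetric G U) (hy : y ∈ U) (v : E) :
    fderiv ℝ (density G) y v = density G y * tr (christoffel G y v) := by
  have h1 : HasFDerivAt (fun z ↦ gramDet (G z)) (fderiv ℝ gramDet (G y) ∘L fderiv ℝ G y) y :=
    (contDiff_gramDet.differentiable (by simp) (G y)).hasFDerivAt.comp y
      (hG.differentiableAt hy).hasFDerivAt
  have h2 : HasFDerivAt (density G) _ y := h1.sqrt (hG.gramDet_pos hy).ne'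
  rw [h2.fderiv]
  simp only [smul_apply, ContinuousLinearMap.comp_apply, smul_eq_mul]
  rw [fderiv_gramDet (hG.compatible hy v)]
  have h3 : √(gramDet (G y)) ^ 2 = gramDet (G y) := Real.sq_sqrt (hG.gramDet_pos hy).le
  have h4 := (hG.density_pos hy).ne'
  simp only [density] at h4 ⊢
  field_simp
  rw [h3]

end IsLocalMetric

end LocalDensity

end RBSoliton

/-! ### The divergence theorem and change of variables in a vector space. -/

namespace RBSoliton

noncomputable section LocalIntegral

set_option maxSynthPendingDepth 3

open scoped Topology
open MeasureTheory

variable {E : Type*} [NormedAddCommGroup E] [NormedSpace ℝ E] [FiniteDimensional ℝ E]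
  [MeasurableSpace E] [BorelSpace E] (μ : Measure E) [μ.IsAddHaarMeasure]

omit [FiniteDimensional ℝ E] in
lemma integrable_fderiv {f : E → ℝ} (hf : ContDiff ℝ 1 f) (hc : HasCompactSupport f) (v : E) :
    Integrable (fun y ↦ fderiv ℝ f y v) μ :=
  ((hf.continuous_fderiv one_ne_zero).clm_apply continuous_const).integrable_of_hasCompactSupport
    (hc.fderiv_apply ℝ v)

lemma integral_fderiv_eq_zero {f : E → ℝ} (hf : ContDiff ℝ 1 f) (hc : HasCompactSupport f) (v : E) :
    ∫ y, fderiv ℝ f y v ∂μ = 0 := by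
  have h := integral_mul_fderiv_eq_neg_fderiv_mul_of_integrable (μ := μ) (f := fun _ : E ↦ (1 : ℝ))
    (g := f) (v := v) (by simp) (by simpa using integrable_fderiv μ hf hc v)
    (by simpa using hf.continuous.integrable_of_hasCompactSupport hc)
    (fun _ _ ↦ differentiableAt_const _) (fun x _ ↦ hf.differentiable one_ne_zero x)
  simpa using h

omit [MeasurableSpace E] [BorelSpace E] in
lemma tr_eq_sum (A : E →L[ℝ] E) :
    tr A = ∑ i, (Module.finBasis ℝ E).coord i (A (Module.finBasis ℝ E i)) := by
  rw [tr_apply, LinearMap.trace_eq_matrix_trace ℝ (Module.finBasis ℝ E)]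
  simp [Matrix.trace, LinearMap.toMatrix_apply]

/-- The divergence theorem for compactly supported vector fields on a vector space. -/
lemma integral_tr_fderiv_eq_zero {Z : E → E} (hZ : ContDiff ℝ 1 Z) (hc : HasCompactSupport Z) :
    ∫ y, tr (fderiv ℝ Z y) ∂μ = 0 := by
  let φ (i : Fin (Module.finrank ℝ E)) : E →L[ℝ] ℝ :=
    LinearMap.toContinuousLinearMap ((Module.finBasis ℝ E).coord i)
  have hφ (i) : ContDiff ℝ 1 (fun y ↦ φ i (Z y)) := (φ i).contDiff.comp hZ
  have hφc (i) : HasCompactSupport (fun y ↦ φ i (Z y)) := hc.comp_left (map_zero (φ i))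
  have h1 (y : E) : tr (fderiv ℝ Z y)
      = ∑ i, fderiv ℝ (fun y ↦ φ i (Z y)) y (Module.finBasis ℝ E i) := by
    rw [tr_eq_sum]
    refine Finset.sum_congr rfl fun i _ ↦ ?_
    have := ((φ i).hasFDerivAt.comp y (hZ.differentiable one_ne_zero y).hasFDerivAt).fderiv
    exact (congrArg (fun A : E →L[ℝ] ℝ ↦ A (Module.finBasis ℝ E i)) this).symm
  simp only [h1]
  rw [integral_finsetSum _ fun i _ ↦ integrable_fderiv μ (hφ i) (hφc i) _]
  exact Finset.sum_eq_zero fun i _ ↦ integral_fderiv_eq_zero μ (hφ i) (hφc i) _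

namespace IsLocalMetric

variable {G : E → E →L[ℝ] E →L[ℝ] ℝ} {U : Set E} {y : E}

omit [MeasurableSpace E] [BorelSpace E] in
-- The Riemannian divergence times the density is a Euclidean divergence, because tr Γ_X is the
-- logarithmic derivative of the density. This reduces integration on M to integration on E.
lemma tr_fderiv_density_smul (hG : IsLocalMetric G U) (hy : y ∈ U) {X : E → E}
    (hX : DifferentiableAt ℝ X y) :
    tr (fderiv ℝ (fun z ↦ density G z • X z) y) = localDiv G X y * density G y := by
  have hd := differentiableAt_of_contDiffOn hG.isOpen hy hG.contDiffOn_density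
  rw [fderiv_fun_smul hd hX, map_add, localDiv, covDeriv, map_add]
  have h1 : (christoffel G y).flip (X y) = christoffel G y (X y) := by
    ext u
    exact hG.christoffel_comm hy u (X y)
  have h2 : tr ((fderiv ℝ (density G) y).smulRight (X y)) = fderiv ℝ (density G) y (X y) := by
    rw [tr_apply]
    exact LinearMap.trace_smulRight (fderiv ℝ (density G) y : E →ₗ[ℝ] ℝ) (X y)
  rw [h2, h1, hG.fderiv_density hy, map_smul, smul_eq_mul]
  ring

lemma setIntegral_localDiv (hG : IsLocalMetric G U) {X : E → E} (hX : ContDiffOn ℝ 1 X U)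
    {K : Set E} (hK : IsCompact K) (hKU : K ⊆ U) (h0 : ∀ y ∈ U, y ∉ K → X y = 0) :
    ∫ y in U, localDiv G X y * density G y ∂μ = 0 := by
  -- Extension by zero is C¹ on all of E: near a point of U it is the original field, and near a
  -- point outside U ⊇ K it vanishes identically.
  let Z : E → E := U.indicator fun y ↦ density G y • X y
  have hZU {y : E} (hy : y ∈ U) : Z =ᶠ[𝓝 y] fun y ↦ density G y • X y := by
    filter_upwards [hG.mem_nhds hy] with z hz using Set.indicator_of_mem hz _
  have hZ0 (y : E) (hy : y ∉ K) : Z y = 0 := by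
    by_cases h : y ∈ U
    · simp [Z, h, h0 y h hy]
    · simp [Z, h]
  have hZK {y : E} (hy : y ∉ K) : Z =ᶠ[𝓝 y] 0 := by
    filter_upwards [hK.isClosed.isOpen_compl.mem_nhds hy] with z hz using hZ0 z hz
  have hZs : ContDiff ℝ 1 Z := by
    rw [contDiff_iff_contDiffAt]
    intro y
    by_cases hy : y ∈ U
    · have h1 : ContDiffAt ℝ 1 (density G) y :=
        (hG.contDiffOn_density.contDiffAt (hG.mem_nhds hy)).of_le (by simp)
      exact (h1.smul (hX.contDiffAt (hG.mem_nhds hy))).congr_of_eventuallyEq (hZU hy)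
    · exact contDiffAt_const.congr_of_eventuallyEq (hZK fun h ↦ hy (hKU h))
  have hZc : HasCompactSupport Z := HasCompactSupport.intro hK hZ0
  rw [← integral_tr_fderiv_eq_zero μ hZs hZc]
  have h1 : ∫ y in U, tr (fderiv ℝ Z y) ∂μ = ∫ y, tr (fderiv ℝ Z y) ∂μ := by
    refine setIntegral_eq_integral_of_forall_compl_eq_zero fun y hy ↦ ?_
    rw [(hZK fun h ↦ hy (hKU h)).fderiv_eq]
    simp
  rw [← h1]
  refine setIntegral_congr_fun hG.isOpen.measurableSet fun y hy ↦ ?_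
  rw [(hZU hy).fderiv_eq, hG.tr_fderiv_density_smul hy
    ((hX.contDiffAt (hG.mem_nhds hy)).differentiableAt one_ne_zero)]

/-- Invariance of the Riemannian integral under a change of coordinates. -/
lemma setIntegral_change {G' : E → E →L[ℝ] E →L[ℝ] ℝ} {φ : E → E}
    {V : Set E} (hV : IsOpen V) (hφ : ∀ y ∈ V, DifferentiableAt ℝ φ y) (hinj : V.InjOn φ)
    (hG : ∀ y ∈ V, ∀ u v, G' y u v = G (φ y) (fderiv ℝ φ y u) (fderiv ℝ φ y v)) (f : E → ℝ) :
    ∫ y in φ '' V, f y * density G y ∂μ = ∫ y in V, f (φ y) * density G' y ∂μ := by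
  rw [integral_image_eq_integral_abs_det_fderiv_smul μ hV.measurableSet
    (fun y hy ↦ (hφ y hy).hasFDerivAt.hasFDerivWithinAt) hinj]
  refine setIntegral_congr_fun hV.measurableSet fun y hy ↦ ?_
  simp only [density, smul_eq_mul]
  -- The root of det(dφ)² is precisely the Jacobian factor |det dφ|, so no orientation is needed.
  rw [gramDet_comp (hG y hy), Real.sqrt_mul (sq_nonneg _), Real.sqrt_sq_eq_abs]
  ring

end IsLocalMetric

end LocalIntegral

end RBSoliton

/-! ### Coordinate expressions of vector fields, brackets and the metric. -/

namespace RBSoliton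

noncomputable section Charts

set_option maxSynthPendingDepth 3
set_option linter.unusedSectionVars false

open scoped Topology
open VectorField

variable {E : Type*} [NormedAddCommGroup E] [NormedSpace ℝ E] [FiniteDimensional ℝ E]
  {M : Type*} [TopologicalSpace M] [ChartedSpace E M]
  [IsManifold 𝓘(ℝ, E) ∞ M]

variable (E) in
/-- The inverse of the chart at `p`. -/
def param (p : M) : E → M := (extChartAt 𝓘(ℝ, E) p).symm

variable (E) in
/-- The target of the chart at `p`. -/
def dom (p : M) : Set E := (extChartAt 𝓘(ℝ, E) p).target

/-- The derivative of the inverse of the chart at `p`. -/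
def dparam (p : M) (y : E) : E →L[ℝ] TangentSpace 𝓘(ℝ, E) (param E p y) :=
  mfderiv 𝓘(ℝ, E) 𝓘(ℝ, E) (param E p) y

/-- The coordinate expression of a vector field in the chart at `p`. -/
def locField (p : M) (X : Π x : M, TangentSpace 𝓘(ℝ, E) x) (y : E) : E :=
  (dparam p y).inverse (X (param E p y))

section Basic

lemma isOpen_dom (p : M) : IsOpen (dom E p) := isOpen_extChartAt_target p

variable {p : M} {y : E}

lemma dom_mem_nhds (hy : y ∈ dom E p) : dom E p ∈ 𝓝 y := (isOpen_dom p).mem_nhds hy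

lemma contMDiffOn_param (p : M) : ContMDiffOn 𝓘(ℝ, E) 𝓘(ℝ, E) ∞ (param E p) (dom E p) :=
  contMDiffOn_extChartAt_symm p

lemma contMDiffAt_param (hy : y ∈ dom E p) :
    ContMDiffAt 𝓘(ℝ, E) 𝓘(ℝ, E) ∞ (param E p) y :=
  (contMDiffOn_param p).contMDiffAt (dom_mem_nhds hy)

lemma isInvertible_dparam (hy : y ∈ dom E p) : (dparam p y).IsInvertible := by
  have := isInvertible_mfderivWithin_extChartAt_symm (I := 𝓘(ℝ, E)) hy
  rw [modelWithCornersSelf_coe, Set.range_id, mfderivWithin_univ] at this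
  exact this

lemma dparam_locField (hy : y ∈ dom E p) (X : Π x : M, TangentSpace 𝓘(ℝ, E) x) :
    dparam p y (locField p X y) = X (param E p y) := by
  obtain ⟨e, he⟩ := isInvertible_dparam hy
  rw [locField, ← he, ContinuousLinearMap.inverse_equiv]
  simp

lemma inverse_dparam_apply (hy : y ∈ dom E p) (u : E) :
    (dparam p y).inverse (dparam p y u) = u := by
  obtain ⟨e, he⟩ := isInvertible_dparam hy
  rw [← he, ContinuousLinearMap.inverse_equiv]
  simp

lemma dparam_inverse_apply (hy : y ∈ dom E p) (u : TangentSpace 𝓘(ℝ, E) (param E p y)) :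
    dparam p y ((dparam p y).inverse u) = u := by
  obtain ⟨e, he⟩ := isInvertible_dparam hy
  rw [← he, ContinuousLinearMap.inverse_equiv]
  simp

lemma contDiffAt_locField {n : ℕ∞ω} (hn : n + 1 ≤ ∞) (hy : y ∈ dom E p)
    {X : Π x : M, TangentSpace 𝓘(ℝ, E) x}
    (hX : ContMDiffAt 𝓘(ℝ, E) 𝓘(ℝ, E).tangent n
      (fun x ↦ (⟨x, X x⟩ : TangentBundle 𝓘(ℝ, E) M)) (param E p y)) :
    ContDiffAt ℝ n (locField p X) y := by
  have : CompleteSpace E := FiniteDimensional.complete ℝ E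
  have : IsManifold 𝓘(ℝ, E) 1 M := IsManifold.of_le (n := ∞) (by simp)
  have h := ContMDiffAt.mpullback_vectorField_preimage (m := n) (n := ∞) (I := 𝓘(ℝ, E)) (E := E)
    (I' := 𝓘(ℝ, E)) (E' := E) (f := param E p) hX (contMDiffAt_param hy)
    (isInvertible_dparam (E := E) hy) hn
  exact (contMDiffAt_vectorSpace_iff_contDiffAt (𝕜 := ℝ) (E := E) (V := locField p X)).1 h

lemma chart_param (hy : y ∈ dom E p) : extChartAt 𝓘(ℝ, E) p (param E p y) = y :=
  (extChartAt 𝓘(ℝ, E) p).right_inv hy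

lemma param_mem_source (hy : y ∈ dom E p) : param E p y ∈ (extChartAt 𝓘(ℝ, E) p).source :=
  (extChartAt 𝓘(ℝ, E) p).map_target hy

lemma exists_eq_param {x : M} (hx : x ∈ (extChartAt 𝓘(ℝ, E) p).source) :
    ∃ y ∈ dom E p, param E p y = x :=
  ⟨_, (extChartAt 𝓘(ℝ, E) p).map_source hx, (extChartAt 𝓘(ℝ, E) p).left_inv hx⟩

lemma source_mem_nhds (hy : y ∈ dom E p) :
    (extChartAt 𝓘(ℝ, E) p).source ∈ 𝓝 (param E p y) :=
  (isOpen_extChartAt_source p).mem_nhds (param_mem_source hy)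

lemma mpullback_locField (hy : y ∈ dom E p) (X : Π x : M, TangentSpace 𝓘(ℝ, E) x) :
    mpullback 𝓘(ℝ, E) 𝓘(ℝ, E) (extChartAt 𝓘(ℝ, E) p) (locField p X) (param E p y)
      = X (param E p y) := by
  have h : (locField p X (extChartAt 𝓘(ℝ, E) p (param E p y)) : E) = locField p X y := by
    rw [chart_param hy]
  have h1 := (mfderiv_extChartAt_comp_mfderivWithin_extChartAt_symm (I := 𝓘(ℝ, E)) hy)
  rw [modelWithCornersSelf_coe, Set.range_id, mfderivWithin_univ] at h1
  have h2 : mfderiv 𝓘(ℝ, E) 𝓘(ℝ, E) (extChartAt 𝓘(ℝ, E) p) (param E p y)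
      (dparam p y (locField p X y)) = locField p X y :=
    congrArg (fun A : E →L[ℝ] E ↦ A (locField p X y)) h1
  rw [dparam_locField hy] at h2
  obtain ⟨e, he⟩ := isInvertible_mfderiv_extChartAt (I := 𝓘(ℝ, E)) (param_mem_source hy)
  refine (congrArg (fun u : E ↦ (mfderiv 𝓘(ℝ, E) 𝓘(ℝ, E) (extChartAt 𝓘(ℝ, E) p)
    (param E p y)).inverse u) h).trans ?_
  rw [← h2, ← he, ContinuousLinearMap.inverse_equiv]
  exact e.symm_apply_apply _

/-- Near the point X is the pull-back of its coordinate expression under the chart. The pull-back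
involves the derivative of the chart, hence the condition n + 1 ≤ ∞. -/
lemma contMDiffAt_of_locField {n : ℕ∞ω} (hn : n + 1 ≤ ∞) (hy : y ∈ dom E p)
    {X : Π x : M, TangentSpace 𝓘(ℝ, E) x} (hX : ContDiffAt ℝ n (locField p X) y) :
    ContMDiffAt 𝓘(ℝ, E) 𝓘(ℝ, E).tangent n
      (fun x ↦ (⟨x, X x⟩ : TangentBundle 𝓘(ℝ, E) M)) (param E p y) := by
  have : CompleteSpace E := FiniteDimensional.complete ℝ E
  have : IsManifold 𝓘(ℝ, E) 1 M := IsManifold.of_le (n := ∞) (by simp)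
  have hX' : ContDiffAt ℝ n (locField p X) (extChartAt 𝓘(ℝ, E) p (param E p y)) := by
    rwa [chart_param hy]
  have hF : ContMDiffAt 𝓘(ℝ, E) 𝓘(ℝ, E) ∞ (extChartAt 𝓘(ℝ, E) p) (param E p y) :=
    contMDiffAt_extChartAt' (by simpa using param_mem_source hy)
  have h := ContMDiffAt.mpullback_vectorField_preimage (m := n) (n := ∞)
    (contMDiffAt_vectorSpace_iff_contDiffAt.2 hX') hF
    (isInvertible_mfderiv_extChartAt (I := 𝓘(ℝ, E)) (param_mem_source hy)) hn
  refine h.congr_of_eventuallyEq ?_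
  filter_upwards [source_mem_nhds hy] with x hx
  obtain ⟨z, hz, rfl⟩ := exists_eq_param hx
  rw [mpullback_locField hz]

lemma mdifferentiableAt_of_comp_param {F : Type*} [NormedAddCommGroup F] [NormedSpace ℝ F]
    (hy : y ∈ dom E p) {f : M → F}
    (hf : DifferentiableAt ℝ (f ∘ param E p) y) :
    MDifferentiableAt 𝓘(ℝ, E) 𝓘(ℝ, F) f (param E p y) := by
  have hF : MDifferentiableAt 𝓘(ℝ, E) 𝓘(ℝ, E) (extChartAt 𝓘(ℝ, E) p) (param E p y) :=
    mdifferentiableAt_extChartAt (by simpa using param_mem_source hy)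
  rw [← chart_param hy] at hf
  have h := (hf.mdifferentiableAt).comp (param E p y) hF
  refine h.congr_of_eventuallyEq ?_
  filter_upwards [source_mem_nhds hy] with x hx
  obtain ⟨z, hz, rfl⟩ := exists_eq_param hx
  simp only [Function.comp_apply, chart_param hz]

lemma mvfderiv_param {F : Type*} [NormedAddCommGroup F] [NormedSpace ℝ F]
    (hy : y ∈ dom E p) {f : M → F} (hf : DifferentiableAt ℝ (f ∘ param E p) y)
    (X : Π x : M, TangentSpace 𝓘(ℝ, E) x) :
    mvfderiv 𝓘(ℝ, E) f (param E p y) (X (param E p y))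
      = fderiv ℝ (f ∘ param E p) y (locField p X y) := by
  have h := mfderiv_comp y (mdifferentiableAt_of_comp_param hy hf)
    ((contMDiffAt_param hy).mdifferentiableAt (by simp))
  rw [mfderiv_eq_fderiv] at h
  rw [← dparam_locField hy X]
  exact (congrArg (fun A : E →L[ℝ] F ↦ A (locField p X y)) h).symm

lemma locField_mlieBracket (hy : y ∈ dom E p) {X Y : Π x : M, TangentSpace 𝓘(ℝ, E) x}
    (hX : ContDiffAt ℝ 1 (locField p X) y) (hY : ContDiffAt ℝ 1 (locField p Y) y) :
    locField p (mlieBracket 𝓘(ℝ, E) X Y) y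
      = fderiv ℝ (locField p Y) y (locField p X y) - fderiv ℝ (locField p X) y (locField p Y y) := by
  have : CompleteSpace E := FiniteDimensional.complete ℝ E
  have h12 : (1 : ℕ∞ω) + 1 ≤ ∞ := by
    exact (WithTop.coe_le_coe.2 le_top : (((1 : ℕ∞) + 1 : ℕ∞) : ℕ∞ω) ≤ ∞)
  have h2 : minSmoothness ℝ 2 ≤ ∞ := by
    simpa using (WithTop.coe_le_coe.2 le_top : ((2 : ℕ∞) : ℕ∞ω) ≤ ∞)
  have : IsManifold 𝓘(ℝ, E) (minSmoothness ℝ 2) M := IsManifold.of_le (n := ∞) h2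
  have h := mpullback_mlieBracket (I := 𝓘(ℝ, E)) (I' := 𝓘(ℝ, E)) (n := ∞)
    ((contMDiffAt_of_locField h12 hy hX).mdifferentiableAt one_ne_zero)
    ((contMDiffAt_of_locField h12 hy hY).mdifferentiableAt one_ne_zero) (contMDiffAt_param hy) h2
  rw [← mlieBracketWithin_univ (I := 𝓘(ℝ, E)) (M := E), mlieBracketWithin_eq_lieBracketWithin] at h
  exact h.trans (congrFun (lieBracketWithin_univ (𝕜 := ℝ) (V := locField p X) (W := locField p Y)) y)

lemma contMDiffOn_dparam (p : M) (u : E) : ContMDiffOn 𝓘(ℝ, E) 𝓘(ℝ, E).tangent ∞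
    (fun y ↦ (⟨param E p y, dparam p y u⟩ : TangentBundle 𝓘(ℝ, E) M)) (dom E p) := by
  have : IsManifold 𝓘(ℝ, E) 1 M := IsManifold.of_le (n := ∞) (by simp)
  have h := (contMDiffOn_param p).contMDiffOn_tangentMapWithin (m := ∞) (by simp)
    (isOpen_dom (E := E) p).uniqueMDiffOn
  have hc : ContMDiff 𝓘(ℝ, E) 𝓘(ℝ, E).tangent ∞ (fun y : E ↦ (⟨y, u⟩ : TangentBundle 𝓘(ℝ, E) E)) :=
    contMDiff_vectorSpace_iff_contDiff.2 contDiff_const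
  refine (h.comp hc.contMDiffOn (s := dom E p) fun y hy ↦ hy).congr fun y hy ↦ ?_
  simp only [Function.comp_apply, tangentMapWithin, dparam]
  rw [mfderivWithin_of_isOpen (isOpen_dom p) hy]
  rfl

end Basic

section Riemannian

variable [RiemannianBundle (fun x : M ↦ TangentSpace 𝓘(ℝ, E) x)] {p : M} {y : E}

/-- The coordinate expression of the metric in the chart at `p`. -/
def locMetric (p : M) (y : E) : E →L[ℝ] E →L[ℝ] ℝ :=
  (innerSL ℝ (E := TangentSpace 𝓘(ℝ, E) (param E p y))).bilinearComp (dparam p y) (dparam p y)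

lemma locMetric_apply (p : M) (y u v : E) :
    locMetric p y u v = inner ℝ (dparam p y u) (dparam p y v) := rfl

lemma metric_param (hy : y ∈ dom E p) (X Y : Π x : M, TangentSpace 𝓘(ℝ, E) x) :
    metric (E := E) X Y (param E p y) = locMetric p y (locField p X y) (locField p Y y) := by
  change _ = inner ℝ (dparam p y (locField p X y)) (dparam p y (locField p Y y))
  rw [dparam_locField hy, dparam_locField hy]
  rfl

variable [IsContMDiffRiemannianBundle 𝓘(ℝ, E) ∞ E (fun x : M ↦ TangentSpace 𝓘(ℝ, E) x)]

lemma contDiffOn_locMetric (p : M) : ContDiffOn ℝ ∞ (locMetric p) (dom E p) := by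
  rw [contDiffOn_clm_apply]
  intro u
  rw [contDiffOn_clm_apply]
  intro v
  rw [← contMDiffOn_iff_contDiffOn]
  exact ContMDiffOn.inner_bundle (F := E) (E := fun x : M ↦ TangentSpace 𝓘(ℝ, E) x)
    (b := param E p) (v := fun y ↦ dparam p y u) (w := fun y ↦ dparam p y v)
    (contMDiffOn_dparam p u) (contMDiffOn_dparam p v)

lemma isLocalMetric (p : M) : IsLocalMetric (locMetric (E := E) p) (dom E p) where
  isOpen := isOpen_dom p
  smooth := contDiffOn_locMetric p
  symm y hy u v := by simp only [locMetric_apply, real_inner_comm]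
  pos y hy v hv := by
    rw [locMetric_apply]
    refine real_inner_self_pos.2 fun h ↦ hv ?_
    rw [← inverse_dparam_apply hy v, h, map_zero]

end Riemannian

end Charts

end RBSoliton

/-! ### Identification of the intrinsic tensors with their coordinate formulas. -/

namespace RBSoliton

noncomputable section Transfer

set_option maxSynthPendingDepth 3
set_option linter.unusedSectionVars false

open scoped Topology
open VectorField

variable {E : Type*} [NormedAddCommGroup E] [NormedSpace ℝ E] [FiniteDimensional ℝ E]

lemma one_add_one_le_infty : (1 : ℕ∞ω) + 1 ≤ ∞ :=
  (WithTop.coe_le_coe.2 le_top : (((1 : ℕ∞) + 1 : ℕ∞) : ℕ∞ω) ≤ ∞)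

lemma two_add_one_le_infty : (2 : ℕ∞ω) + 1 ≤ ∞ :=
  (WithTop.coe_le_coe.2 le_top : (((2 : ℕ∞) + 1 : ℕ∞) : ℕ∞ω) ≤ ∞)

section Local

variable {G : E → E →L[ℝ] E →L[ℝ] ℝ} {U : Set E} {y : E}

lemma differentiableAt_fderiv {Z : E → E} (hZ : ContDiffAt ℝ 2 Z y) :
    DifferentiableAt ℝ (fderiv ℝ Z) y :=
  (hZ.fderiv_right (m := 1) (by norm_num [one_add_one_eq_two])).differentiableAt one_ne_zero

lemma IsLocalMetric.contDiffAt_covDeriv_apply (hG : IsLocalMetric G U) (hy : y ∈ U)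
    {Y Z : E → E} (hY : ContDiffAt ℝ 1 Y y) (hZ : ContDiffAt ℝ 2 Z y) :
    ContDiffAt ℝ 1 (fun z ↦ covDeriv G Z z (Y z)) y := by
  have h1 : ContDiffAt ℝ 1 (fderiv ℝ Z) y :=
    hZ.fderiv_right (by norm_num [one_add_one_eq_two])
  have h2 : ContDiffAt ℝ 1 (christoffel G) y :=
    (hG.contDiffOn_christoffel.contDiffAt (hG.mem_nhds hy)).of_le (by simp)
  simp only [covDeriv_apply]
  exact (h1.clm_apply hY).add ((h2.clm_apply hY).clm_apply (hZ.of_le one_le_two))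

/-- The curvature tensor measures the failure of second covariant derivatives to commute. -/
lemma IsLocalMetric.covDeriv_commutator (hG : IsLocalMetric G U) (hy : y ∈ U) {X Y Z : E → E}
    (hX : ContDiffAt ℝ 1 X y) (hY : ContDiffAt ℝ 1 Y y) (hZ : ContDiffAt ℝ 2 Z y) :
    covDeriv G (fun z ↦ covDeriv G Z z (Y z)) y (X y)
        - covDeriv G (fun z ↦ covDeriv G Z z (X z)) y (Y y)
        - covDeriv G Z y (fderiv ℝ Y y (X y) - fderiv ℝ X y (Y y))
      = localCurvature G y (X y) (Y y) (Z y) := by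
  have hΓ := hG.differentiableAt_christoffel hy
  have hZd := hZ.differentiableAt two_ne_zero
  have hD := differentiableAt_fderiv hZ
  have key {Y : E → E} (hY : ContDiffAt ℝ 1 Y y) (x : E) :
      covDeriv G (fun z ↦ covDeriv G Z z (Y z)) y x
        = fderiv ℝ (fderiv ℝ Z) y x (Y y) + fderiv ℝ Z y (fderiv ℝ Y y x)
          + (fderiv ℝ (christoffel G) y x (Y y) (Z y) + christoffel G y (fderiv ℝ Y y x) (Z y)
            + christoffel G y (Y y) (fderiv ℝ Z y x))
          + christoffel G y x (fderiv ℝ Z y (Y y) + christoffel G y (Y y) (Z y)) := by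
    have hYd := hY.differentiableAt one_ne_zero
    have h1 : DifferentiableAt ℝ (fun z ↦ fderiv ℝ Z z (Y z)) y := hD.clm_apply hYd
    have h2 : DifferentiableAt ℝ (fun z ↦ christoffel G z (Y z) (Z z)) y :=
      (hΓ.clm_apply hYd).clm_apply hZd
    rw [covDeriv_apply]
    simp only [covDeriv_apply]
    rw [fderiv_fun_add h1 h2, add_apply, fderiv_clm_apply₂ hΓ hYd hZd,
      (hD.hasFDerivAt.clm_apply hYd.hasFDerivAt).fderiv]
    simp only [add_apply, ContinuousLinearMap.comp_apply, ContinuousLinearMap.flip_apply]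
    abel
  have hsymm : fderiv ℝ (fderiv ℝ Z) y (X y) (Y y) = fderiv ℝ (fderiv ℝ Z) y (Y y) (X y) :=
    (hZ.isSymmSndFDerivAt (by simp)).eq _ _
  rw [key hX, key hY, hsymm, covDeriv_apply, localCurvature_apply]
  simp only [map_sub, map_add, add_apply, sub_apply, ContinuousLinearMap.comp_apply]
  abel

end Local

variable {M : Type*} [TopologicalSpace M] [ChartedSpace E M]
  [IsManifold 𝓘(ℝ, E) ∞ M] [RiemannianBundle (fun x : M ↦ TangentSpace 𝓘(ℝ, E) x)]
  [IsContMDiffRiemannianBundle 𝓘(ℝ, E) ∞ E (fun x : M ↦ TangentSpace 𝓘(ℝ, E) x)]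
  {p : M} {y : E} {X Y Z : Π x : M, TangentSpace 𝓘(ℝ, E) x}

lemma metric_comp_param (hy : y ∈ dom E p) (X Y : Π x : M, TangentSpace 𝓘(ℝ, E) x) :
    metric X Y ∘ param E p
      =ᶠ[𝓝 y] fun z ↦ locMetric p z (locField p X z) (locField p Y z) := by
  filter_upwards [dom_mem_nhds hy] with z hz using metric_param hz X Y

lemma mvfderiv_metric (hy : y ∈ dom E p) (hY : ContDiffAt ℝ 1 (locField p Y) y)
    (hZ : ContDiffAt ℝ 1 (locField p Z) y) :
    mvfderiv 𝓘(ℝ, E) (metric Y Z) (param E p y) (X (param E p y))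
      = fderiv ℝ (locMetric p) y (locField p X y) (locField p Y y) (locField p Z y)
        + locMetric p y (fderiv ℝ (locField p Y) y (locField p X y)) (locField p Z y)
        + locMetric p y (locField p Y y) (fderiv ℝ (locField p Z) y (locField p X y)) := by
  have hg := (isLocalMetric (E := E) p).differentiableAt hy
  have hYd := hY.differentiableAt one_ne_zero
  have hZd := hZ.differentiableAt one_ne_zero
  have h := metric_comp_param hy Y Z
  have hd : DifferentiableAt ℝ (fun z ↦ locMetric p z (locField p Y z) (locField p Z z)) y :=
    (hg.clm_apply hYd).clm_apply hZd
  rw [mvfderiv_param hy (hd.congr_of_eventuallyEq h), h.fderiv_eq, fderiv_clm_apply₂ hg hYd hZd]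

/-- All derivatives of X and Z cancel against the brackets, so the Koszul expression depends on them
only through their values at the point. -/
lemma koszul_param (hy : y ∈ dom E p) (hX : ContDiffAt ℝ 1 (locField p X) y)
    (hY : ContDiffAt ℝ 1 (locField p Y) y) (hZ : ContDiffAt ℝ 1 (locField p Z) y) :
    koszul X Y Z (param E p y)
      = locMetric p y (covDeriv (locMetric p) (locField p Y) y (locField p X y))
          (locField p Z y) := by
  have hG := isLocalMetric (E := E) p
  rw [koszul, mvfderiv_metric hy hY hZ, mvfderiv_metric hy hZ hX, mvfderiv_metric hy hX hY,
    metric_param hy, metric_param hy, metric_param hy, locField_mlieBracket hy hX hY,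
    locField_mlieBracket hy hX hZ, locField_mlieBracket hy hY hZ, covDeriv_apply]
  simp only [map_add, map_sub, add_apply, sub_apply, hG.christoffel_pairing hy]
  rw [hG.symm y hy (locField p Y y), hG.symm y hy (locField p Z y), hG.symm y hy (locField p X y)]
  ring

lemma contDiffAt_locField_extField {n : ℕ∞ω} (hn : n + 1 ≤ ∞) (hy : y ∈ dom E p)
    (v : TangentSpace 𝓘(ℝ, E) (param E p y)) : ContDiffAt ℝ n (locField p (extField v)) y := by
  have : IsManifold 𝓘(ℝ, E) (n + 1) M := IsManifold.of_le hn
  have : IsManifold 𝓘(ℝ, E) 1 M := IsManifold.of_le (n := ∞) (by simp)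
  exact contDiffAt_locField hn hy
    (contMDiffAt_extend 𝓘(ℝ, E) E (V := fun x : M ↦ TangentSpace 𝓘(ℝ, E) x) v)

lemma locField_extField (v : TangentSpace 𝓘(ℝ, E) (param E p y)) :
    locField p (extField v) y = (dparam p y).inverse v := by
  rw [locField, extField, extend_apply_self]

lemma leviCivita_param (hy : y ∈ dom E p) (hX : ContDiffAt ℝ 1 (locField p X) y)
    (hY : ContDiffAt ℝ 1 (locField p Y) y) :
    leviCivita X Y (param E p y)
      = dparam p y (covDeriv (locMetric p) (locField p Y) y (locField p X y)) := by
  rw [leviCivita]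
  conv_rhs => rw [← (orthoBasis (E := E) (param E p y)).sum_repr' (dparam p y _)]
  refine Finset.sum_congr rfl fun i _ ↦ ?_
  rw [koszul_param hy hX hY (contDiffAt_locField_extField one_add_one_le_infty hy _),
    locMetric_apply, locField_extField, dparam_inverse_apply hy, real_inner_comm]

lemma locField_leviCivita (hy : y ∈ dom E p) (hX : ContDiffAt ℝ 1 (locField p X) y)
    (hY : ContDiffAt ℝ 1 (locField p Y) y) :
    locField p (leviCivita X Y) y
      = covDeriv (locMetric p) (locField p Y) y (locField p X y) := by
  rw [locField, leviCivita_param hy hX hY, inverse_dparam_apply hy]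

/-- The iterated connection differentiates ∇_X Y, so its coordinate formula is needed on a
neighbourhood. Being C¹ at y already holds near y. -/
lemma locField_leviCivita_eventuallyEq (hy : y ∈ dom E p) (hX : ContDiffAt ℝ 1 (locField p X) y)
    (hY : ContDiffAt ℝ 1 (locField p Y) y) :
    locField p (leviCivita X Y)
      =ᶠ[𝓝 y] fun z ↦ covDeriv (locMetric p) (locField p Y) z (locField p X z) := by
  filter_upwards [dom_mem_nhds hy, hX.eventually (by simp), hY.eventually (by simp)]
    with z hz hXz hYz using locField_leviCivita hz hXz hYz

lemma leviCivita_leviCivita_param (hy : y ∈ dom E p) (hX : ContDiffAt ℝ 1 (locField p X) y)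
    (hY : ContDiffAt ℝ 1 (locField p Y) y) (hZ : ContDiffAt ℝ 2 (locField p Z) y) :
    leviCivita X (leviCivita Y Z) (param E p y) = dparam p y (covDeriv (locMetric p)
      (fun z ↦ covDeriv (locMetric p) (locField p Z) z (locField p Y z)) y (locField p X y)) := by
  have h := locField_leviCivita_eventuallyEq hy hY (hZ.of_le one_le_two)
  have h1 := ((isLocalMetric (E := E) p).contDiffAt_covDeriv_apply hy hY hZ).congr_of_eventuallyEq h
  rw [leviCivita_param hy hX h1, covDeriv_apply, covDeriv_apply, h.fderiv_eq, h.eq_of_nhds]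

/-- The answer involves only the values of the fields at the point, so the particular extensions
chosen in `ricci` do not matter. -/
lemma curvature_param (hy : y ∈ dom E p) (hX : ContDiffAt ℝ 2 (locField p X) y)
    (hY : ContDiffAt ℝ 2 (locField p Y) y) (hZ : ContDiffAt ℝ 2 (locField p Z) y) :
    curvature X Y Z (param E p y)
      = dparam p y (localCurvature (locMetric p) y (locField p X y) (locField p Y y)
          (locField p Z y)) := by
  have hX1 := hX.of_le one_le_two
  have hY1 := hY.of_le one_le_two
  have hZ1 := hZ.of_le one_le_two
  have hb : locField p (mlieBracket 𝓘(ℝ, E) X Y) =ᶠ[𝓝 y]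
      fun z ↦ fderiv ℝ (locField p Y) z (locField p X z)
        - fderiv ℝ (locField p X) z (locField p Y z) := by
    filter_upwards [dom_mem_nhds hy, hX1.eventually (by simp), hY1.eventually (by simp)]
      with z hz hXz hYz using locField_mlieBracket hz hXz hYz
  have hb1 : ContDiffAt ℝ 1 (locField p (mlieBracket 𝓘(ℝ, E) X Y)) y := by
    refine ContDiffAt.congr_of_eventuallyEq ?_ hb
    have h1 : ContDiffAt ℝ 1 (fderiv ℝ (locField p X)) y :=
      hX.fderiv_right (by norm_num [one_add_one_eq_two])
    have h2 : ContDiffAt ℝ 1 (fderiv ℝ (locField p Y)) y :=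
      hY.fderiv_right (by norm_num [one_add_one_eq_two])
    exact (h2.clm_apply hX1).sub (h1.clm_apply hY1)
  rw [curvature, leviCivita_leviCivita_param hy hX1 hY1 hZ, leviCivita_leviCivita_param hy hY1 hX1 hZ,
    leviCivita_param hy hb1 hZ1, hb.eq_of_nhds, ← map_sub, ← map_sub,
    (isLocalMetric (E := E) p).covDeriv_commutator hy hX1 hY1 hZ]

variable (E) in
/-- An orthonormal frame at `param p y`, in coordinates. -/
def frame (p : M) (y : E) (i : Fin (Module.finrank ℝ E)) : E :=
  (dparam p y).inverse (orthoBasis (E := E) (param E p y) i)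

lemma dparam_frame (hy : y ∈ dom E p) (i : Fin (Module.finrank ℝ E)) :
    dparam p y (frame E p y i) = orthoBasis (E := E) (param E p y) i :=
  dparam_inverse_apply hy _

/-- The trace is invariant under conjugation by `dparam p y`, which carries the frame to an
orthonormal basis of the tangent space. -/
lemma tr_frame (hy : y ∈ dom E p) (A : E →L[ℝ] E) :
    tr A = ∑ i, locMetric p y (A (frame E p y i)) (frame E p y i) := by
  obtain ⟨e, he⟩ := isInvertible_dparam hy
  have h1 : tr A = LinearMap.trace ℝ (TangentSpace 𝓘(ℝ, E) (param E p y))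
      (e.toLinearEquiv.conj (A : E →ₗ[ℝ] E)) := by
    rw [LinearMap.trace_conj', tr_apply]
  rw [h1, LinearMap.trace_eq_sum_inner _ (orthoBasis (E := E) (param E p y))]
  refine Finset.sum_congr rfl fun i _ ↦ ?_
  rw [locMetric_apply, dparam_frame hy, real_inner_comm]
  congr 1
  rw [frame, ← he, ContinuousLinearMap.inverse_equiv]
  rfl

lemma ricci_param (hy : y ∈ dom E p) (u v : E) :
    ricci (param E p y) (dparam p y u) (dparam p y v) = localRicci (locMetric p) y u v := by
  rw [ricci, localRicci, contract_apply, tr_frame hy]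
  refine Finset.sum_congr rfl fun i _ ↦ ?_
  have hc (v : TangentSpace 𝓘(ℝ, E) (param E p y)) :=
    contDiffAt_locField_extField two_add_one_le_infty hy v
  rw [curvature_param hy (hc _) (hc _) (hc _), locMetric_apply, dparam_frame hy,
    locField_extField, locField_extField, locField_extField, inverse_dparam_apply hy,
    inverse_dparam_apply hy]
  rfl

lemma scalarCurvature_param (hy : y ∈ dom E p) :
    scalarCurvature E (param E p y) = localScalar (locMetric p) y := by
  rw [scalarCurvature, localScalar, tr_frame hy]
  refine Finset.sum_congr rfl fun i _ ↦ ?_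
  rw [← dparam_frame hy, ricci_param hy, (isLocalMetric (E := E) p).ricciOp_pairing hy]

lemma lieMetric_param (hy : y ∈ dom E p) (hX : ContDiffAt ℝ 1 (locField p X) y) (u v : E) :
    lieMetric X (param E p y) (dparam p y u) (dparam p y v)
      = localLie (locMetric p) (locField p X) y u v := by
  have hc (v : TangentSpace 𝓘(ℝ, E) (param E p y)) :=
    contDiffAt_locField_extField one_add_one_le_infty hy v
  rw [lieMetric, mvfderiv_metric hy (hc _) (hc _), metric_param hy, metric_param hy,
    locField_mlieBracket hy hX (hc _), locField_mlieBracket hy hX (hc _), locField_extField,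
    locField_extField, inverse_dparam_apply hy, inverse_dparam_apply hy, localLie]
  simp only [map_sub, sub_apply]
  ring

end Transfer

end RBSoliton

/-! ### Divergence on the manifold and chart-independent integration. -/

namespace RBSoliton

noncomputable section Divergence

set_option maxSynthPendingDepth 3
set_option linter.unusedSectionVars false

open scoped Topology
open VectorField MeasureTheory

variable {E : Type*} [NormedAddCommGroup E] [NormedSpace ℝ E] [FiniteDimensional ℝ E]

lemma localDiv_smul {G : E → E →L[ℝ] E →L[ℝ] ℝ} {f : E → ℝ} {X : E → E} {y : E}
    (hf : DifferentiableAt ℝ f y) (hX : DifferentiableAt ℝ X y) :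
    localDiv G (fun z ↦ f z • X z) y = f y * localDiv G X y + fderiv ℝ f y (X y) := by
  have h2 : tr ((fderiv ℝ f y).smulRight (X y)) = fderiv ℝ f y (X y) := by
    rw [tr_apply]
    exact LinearMap.trace_smulRight (fderiv ℝ f y : E →ₗ[ℝ] ℝ) (X y)
  rw [localDiv, covDeriv, fderiv_fun_smul hf hX, map_add, map_add, map_smul, map_smul, map_smul, h2,
    localDiv, covDeriv, map_add]
  simp only [smul_eq_mul]
  ring

lemma localDiv_sub {G : E → E →L[ℝ] E →L[ℝ] ℝ} {X Y : E → E} {y : E}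
    (hX : DifferentiableAt ℝ X y) (hY : DifferentiableAt ℝ Y y) :
    localDiv G (fun z ↦ X z - Y z) y = localDiv G X y - localDiv G Y y := by
  simp only [localDiv, covDeriv]
  rw [fderiv_fun_sub hX hY]
  simp only [map_add, map_sub]
  ring

variable {M : Type*} [TopologicalSpace M] [ChartedSpace E M]
  [IsManifold 𝓘(ℝ, E) ∞ M]

variable (E) in
/-- A function with smooth coordinate expressions. -/
def IsSmoothFun (f : M → ℝ) : Prop := ∀ p, ContDiffOn ℝ ∞ (f ∘ param E p) (dom E p)

/-- A vector field with smooth coordinate expressions. -/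
def IsSmoothField (X : Π x : M, TangentSpace 𝓘(ℝ, E) x) : Prop :=
  ∀ p, ContDiffOn ℝ ∞ (locField p X) (dom E p)

variable {X Y : Π x : M, TangentSpace 𝓘(ℝ, E) x} {f : M → ℝ} {p q : M} {y : E}

lemma isSmoothFun_of_contMDiff (hf : ContMDiff 𝓘(ℝ, E) 𝓘(ℝ) ∞ f) : IsSmoothFun E f := fun p ↦
  contMDiffOn_iff_contDiffOn.1 (hf.comp_contMDiffOn (contMDiffOn_param p))

lemma isSmoothField_of_contMDiff (hX : ContMDiff 𝓘(ℝ, E) 𝓘(ℝ, E).tangent ∞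
    (fun x ↦ (⟨x, X x⟩ : TangentBundle 𝓘(ℝ, E) M))) : IsSmoothField X := fun p y hy ↦
  (contDiffAt_locField (by simp) hy (hX _)).contDiffWithinAt

lemma IsSmoothFun.differentiableAt (hf : IsSmoothFun E f) (hy : y ∈ dom E p) :
    DifferentiableAt ℝ (f ∘ param E p) y :=
  ((hf p).contDiffAt (dom_mem_nhds hy)).differentiableAt (by simp)

lemma IsSmoothField.contDiffAt_one (hX : IsSmoothField X) (hy : y ∈ dom E p) :
    ContDiffAt ℝ 1 (locField p X) y :=
  ((hX p).contDiffAt (dom_mem_nhds hy)).of_le (by simp)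

lemma IsSmoothField.differentiableAt (hX : IsSmoothField X) (hy : y ∈ dom E p) :
    DifferentiableAt ℝ (locField p X) y :=
  (hX.contDiffAt_one hy).differentiableAt one_ne_zero

lemma mem_dom_self (x : M) : extChartAt 𝓘(ℝ, E) x x ∈ dom E x := mem_extChartAt_target x

lemma param_self (x : M) : param E x (extChartAt 𝓘(ℝ, E) x x) = x := extChartAt_to_inv x

lemma continuous_of_comp_param (hf : ∀ p, ContinuousOn (f ∘ param E p) (dom E p)) :
    Continuous f := by
  rw [continuous_iff_continuousAt]
  intro x
  have h1 : ContinuousAt (f ∘ param E x) (extChartAt 𝓘(ℝ, E) x x) :=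
    (hf x).continuousAt (dom_mem_nhds (mem_dom_self x))
  have h2 : ContinuousAt ((f ∘ param E x) ∘ extChartAt 𝓘(ℝ, E) x) x :=
    h1.comp (continuousAt_extChartAt x)
  refine h2.congr ?_
  filter_upwards [extChartAt_source_mem_nhds (I := 𝓘(ℝ, E)) x] with z hz
  exact congrArg f ((extChartAt 𝓘(ℝ, E) x).left_inv hz)

lemma IsSmoothFun.continuous (hf : IsSmoothFun E f) : Continuous f :=
  continuous_of_comp_param fun p ↦ (hf p).continuousOn

lemma locField_smul (f : M → ℝ) (X : Π x : M, TangentSpace 𝓘(ℝ, E) x) :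
    locField p (fun x ↦ f x • X x) = fun y ↦ (f ∘ param E p) y • locField p X y := by
  ext y
  exact map_smul (dparam p y).inverse _ _

lemma IsSmoothField.smul (hf : IsSmoothFun E f) (hX : IsSmoothField X) :
    IsSmoothField (fun x ↦ f x • X x) := fun p ↦ by
  rw [locField_smul]
  exact (hf p).smul (hX p)

variable [RiemannianBundle (fun x : M ↦ TangentSpace 𝓘(ℝ, E) x)]
  [IsContMDiffRiemannianBundle 𝓘(ℝ, E) ∞ E (fun x : M ↦ TangentSpace 𝓘(ℝ, E) x)]

/-- The divergence of a vector field: half the trace of the Lie derivative of the metric. -/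
def divergence (X : Π x : M, TangentSpace 𝓘(ℝ, E) x) (x : M) : ℝ :=
  (1 / 2) * ∑ i, lieMetric X x (orthoBasis (E := E) x i) (orthoBasis (E := E) x i)

lemma divergence_param (hX : IsSmoothField X) (hy : y ∈ dom E p) :
    divergence X (param E p y) = localDiv (locMetric p) (locField p X) y := by
  have h := (isLocalMetric (E := E) p).sum_localLie hy (tr_frame hy) (locField p X)
  simp only [← lieMetric_param hy (hX.contDiffAt_one hy), dparam_frame hy] at h
  rw [divergence, h]
  ring

lemma IsSmoothField.divergence (hX : IsSmoothField X) : IsSmoothFun E (divergence X) := fun p ↦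
  ((isLocalMetric (E := E) p).contDiffOn_localDiv (hX p)).congr
    fun _ hy ↦ divergence_param hX hy

lemma divergence_smul_param (hf : IsSmoothFun E f) (hX : IsSmoothField X) (hy : y ∈ dom E p) :
    RBSoliton.divergence (fun x ↦ f x • X x) (param E p y)
      = f (param E p y) * RBSoliton.divergence X (param E p y)
        + fderiv ℝ (f ∘ param E p) y (locField p X y) := by
  rw [divergence_param (hX.smul hf) hy, locField_smul,
    localDiv_smul (hf.differentiableAt hy) (hX.differentiableAt hy), divergence_param hX hy]
  rfl

section Integral

/-- The inner product of the tangent space at `x`, on the model space. -/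
def innerAt (x : M) (u v : E) : ℝ := @inner ℝ (TangentSpace 𝓘(ℝ, E) x) _ u v

lemma transition_metric (hyp : y ∈ dom E p)
    (hyq : param E p y ∈ (extChartAt 𝓘(ℝ, E) q).source) :
    DifferentiableAt ℝ (extChartAt 𝓘(ℝ, E) q ∘ param E p) y ∧
    ∀ u v : E, locMetric p y u v = locMetric q ((extChartAt 𝓘(ℝ, E) q ∘ param E p) y)
      (fderiv ℝ (extChartAt 𝓘(ℝ, E) q ∘ param E p) y u)
      (fderiv ℝ (extChartAt 𝓘(ℝ, E) q ∘ param E p) y v) := by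
  set φ : E → E := extChartAt 𝓘(ℝ, E) q ∘ param E p with hφ
  have hm : MDifferentiableAt 𝓘(ℝ, E) 𝓘(ℝ, E) φ y := by
    refine MDifferentiableAt.comp y (mdifferentiableAt_extChartAt (by simpa using hyq))
      ((contMDiffAt_param hyp).mdifferentiableAt (by simp))
  have hφy : φ y ∈ dom E q := (extChartAt 𝓘(ℝ, E) q).map_source hyq
  have hx : param E q (φ y) = param E p y := (extChartAt 𝓘(ℝ, E) q).left_inv hyq
  refine ⟨hm.differentiableAt, ?_⟩
  have hev : param E p =ᶠ[𝓝 y] param E q ∘ φ := by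
    have hs : param E p ⁻¹' (extChartAt 𝓘(ℝ, E) q).source ∈ 𝓝 y :=
      (contMDiffAt_param (E := E) hyp).continuousAt.preimage_mem_nhds
        ((isOpen_extChartAt_source (I := 𝓘(ℝ, E)) q).mem_nhds hyq)
    filter_upwards [hs] with z hz using ((extChartAt 𝓘(ℝ, E) q).left_inv hz).symm
  have hc := mfderiv_comp y ((contMDiffAt_param (E := E) hφy).mdifferentiableAt (by simp)) hm
  have hd : (dparam p y : E →L[ℝ] E)
      = (dparam q (φ y) : E →L[ℝ] E) ∘L (fderiv ℝ φ y) := by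
    rw [← mfderiv_eq_fderiv]
    exact hev.mfderiv_eq.trans hc
  -- The tangent spaces at `param E p y` and `param E q (φ y)` belong to equal but not
  -- definitionally equal points; with vectors typed in E, the base point can be rewritten.
  have hi (u v : E) : locMetric p y u v = innerAt (E := E) (param E p y) ((dparam p y : E →L[ℝ] E) u)
      ((dparam p y : E →L[ℝ] E) v) := rfl
  intro u v
  rw [hi, hd, ← hx]
  rfl

variable [MeasurableSpace E] [BorelSpace E] (μ : Measure E) [μ.IsAddHaarMeasure]

/-- The Riemannian integral of a function supported in the chart at `p`. -/
def chartIntegral (p : M) (h : M → ℝ) : ℝ :=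
  ∫ y in dom E p, h (param E p y) * density (locMetric p) y ∂μ

/-- The chart integral may be computed in any chart containing the support. -/
lemma chartIntegral_eq {h : M → ℝ}
    (hp : ∀ x ∉ (extChartAt 𝓘(ℝ, E) p).source, h x = 0)
    (hq : ∀ x ∉ (extChartAt 𝓘(ℝ, E) q).source, h x = 0) :
    chartIntegral μ p h = chartIntegral μ q h := by
  set V : Set E := dom E p ∩ param E p ⁻¹' (extChartAt 𝓘(ℝ, E) q).source with hVdef
  set W : Set E := dom E q ∩ param E q ⁻¹' (extChartAt 𝓘(ℝ, E) p).source with hWdef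
  set φ : E → E := extChartAt 𝓘(ℝ, E) q ∘ param E p with hφ
  have hV : IsOpen V := (contMDiffOn_param p).continuousOn.isOpen_inter_preimage (isOpen_dom p)
    (isOpen_extChartAt_source q)
  have hx {y : E} (hy : y ∈ V) : param E q (φ y) = param E p y :=
    (extChartAt 𝓘(ℝ, E) q).left_inv hy.2
  have himg : φ '' V = W := by
    ext z
    constructor
    · rintro ⟨y, hy, rfl⟩
      refine ⟨(extChartAt 𝓘(ℝ, E) q).map_source hy.2, ?_⟩
      rw [Set.mem_preimage, hx hy]
      exact param_mem_source hy.1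
    · rintro ⟨hz1, hz2⟩
      refine ⟨extChartAt 𝓘(ℝ, E) p (param E q z), ⟨(extChartAt 𝓘(ℝ, E) p).map_source hz2, ?_⟩, ?_⟩
      · have : param E p (extChartAt 𝓘(ℝ, E) p (param E q z)) = param E q z :=
          (extChartAt 𝓘(ℝ, E) p).left_inv hz2
        rw [Set.mem_preimage, this]
        exact param_mem_source hz1
      · have : param E p (extChartAt 𝓘(ℝ, E) p (param E q z)) = param E q z :=
          (extChartAt 𝓘(ℝ, E) p).left_inv hz2
        rw [hφ, Function.comp_apply, this, chart_param hz1]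
  have hinj : V.InjOn φ := by
    intro a ha b hb hab
    have : param E p a = param E p b := by rw [← hx ha, ← hx hb, hab]
    rw [← chart_param ha.1, ← chart_param hb.1, this]
  -- As h vanishes outside each of the two chart domains, both integrals live on the overlap, where
  -- the change of variables applies.
  have h1 : chartIntegral μ p h = ∫ y in V, h (param E p y) * density (locMetric p) y ∂μ := by
    refine setIntegral_eq_of_subset_of_forall_sdiff_eq_zero (isOpen_dom p).measurableSet
      Set.inter_subset_left fun y hy ↦ ?_
    rw [hq _ fun hs ↦ hy.2 ⟨hy.1, hs⟩, zero_mul]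
  have h2 : chartIntegral μ q h = ∫ y in W, h (param E q y) * density (locMetric q) y ∂μ := by
    refine setIntegral_eq_of_subset_of_forall_sdiff_eq_zero (isOpen_dom q).measurableSet
      Set.inter_subset_left fun y hy ↦ ?_
    rw [hp _ fun hs ↦ hy.2 ⟨hy.1, hs⟩, zero_mul]
  rw [h1, h2, ← himg, IsLocalMetric.setIntegral_change μ (G := locMetric q) (G' := locMetric p) hV
    (fun y hy ↦ (transition_metric hy.1 hy.2).1) hinj (fun y hy ↦ (transition_metric hy.1 hy.2).2)
    (fun z ↦ h (param E q z))]
  refine setIntegral_congr_fun hV.measurableSet fun y hy ↦ ?_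
  rw [hx hy]

variable [T2Space M] [CompactSpace M]

lemma isCompact_image_tsupport {h : M → ℝ} (hs : tsupport h ⊆ (extChartAt 𝓘(ℝ, E) p).source) :
    IsCompact (extChartAt 𝓘(ℝ, E) p '' tsupport h) :=
  (isClosed_tsupport h).isCompact.image_of_continuousOn ((continuousOn_extChartAt p).mono hs)

lemma image_tsupport_subset {h : M → ℝ} (hs : tsupport h ⊆ (extChartAt 𝓘(ℝ, E) p).source) :
    extChartAt 𝓘(ℝ, E) p '' tsupport h ⊆ dom E p := by
  rintro _ ⟨x, hx, rfl⟩
  exact (extChartAt 𝓘(ℝ, E) p).map_source (hs hx)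

lemma param_notMem_tsupport {h : M → ℝ} (hy : y ∈ dom E p)
    (hyK : y ∉ extChartAt 𝓘(ℝ, E) p '' tsupport h) : param E p y ∉ tsupport h :=
  fun hx ↦ hyK ⟨_, hx, chart_param hy⟩

lemma continuousOn_integrand {h : M → ℝ} (hc : Continuous h) :
    ContinuousOn (fun y ↦ h (param E p y) * density (locMetric p) y) (dom E p) :=
  (hc.comp_continuousOn (contMDiffOn_param p).continuousOn).mul
    (isLocalMetric (E := E) p).contDiffOn_density.continuousOn

lemma integrableOn_chart {h : M → ℝ} (hc : Continuous h)
    (hs : tsupport h ⊆ (extChartAt 𝓘(ℝ, E) p).source) :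
    IntegrableOn (fun y ↦ h (param E p y) * density (locMetric p) y) (dom E p) μ := by
  have hK := isCompact_image_tsupport (E := E) hs
  have hKU := image_tsupport_subset (E := E) hs
  have h1 : IntegrableOn (fun y ↦ h (param E p y) * density (locMetric p) y)
      (extChartAt 𝓘(ℝ, E) p '' tsupport h) μ :=
    ((continuousOn_integrand hc).mono hKU).integrableOn_compact hK
  refine h1.of_forall_sdiff_eq_zero (isOpen_dom p).measurableSet fun y hy ↦ ?_
  rw [image_eq_zero_of_notMem_tsupport (param_notMem_tsupport hy.1 hy.2), zero_mul]

end Integral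

end Divergence

end RBSoliton

/-! ### The divergence theorem on a closed manifold. -/

namespace RBSoliton

noncomputable section DivergenceTheorem

set_option maxSynthPendingDepth 3
set_option linter.unusedSectionVars false

open scoped Topology
open VectorField MeasureTheory

variable {E : Type*} [NormedAddCommGroup E] [NormedSpace ℝ E] [FiniteDimensional ℝ E]
  {M : Type*} [TopologicalSpace M] [ChartedSpace E M]
  [IsManifold 𝓘(ℝ, E) ∞ M] [RiemannianBundle (fun x : M ↦ TangentSpace 𝓘(ℝ, E) x)]
  [IsContMDiffRiemannianBundle 𝓘(ℝ, E) ∞ E (fun x : M ↦ TangentSpace 𝓘(ℝ, E) x)]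
  [T2Space M] [CompactSpace M]
  {X : Π x : M, TangentSpace 𝓘(ℝ, E) x}

section

variable [MeasurableSpace E] [BorelSpace E] (μ : Measure E) [μ.IsAddHaarMeasure]

lemma chartIntegral_sum {ι : Type*} (s : Finset ι) {p : M} {h : ι → M → ℝ}
    (hc : ∀ k ∈ s, Continuous (h k))
    (hs : ∀ k ∈ s, tsupport (h k) ⊆ (extChartAt 𝓘(ℝ, E) p).source) :
    chartIntegral μ p (fun x ↦ ∑ k ∈ s, h k x) = ∑ k ∈ s, chartIntegral μ p (h k) := by
  simp only [chartIntegral, Finset.sum_mul]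
  exact integral_finsetSum s fun k hk ↦ integrableOn_chart μ (hc k hk) (hs k hk)

lemma chartIntegral_nonneg {p : M} {h : M → ℝ} (h0 : ∀ x, 0 ≤ h x) : 0 ≤ chartIntegral μ p h :=
  setIntegral_nonneg (isOpen_dom p).measurableSet fun _ hy ↦
    mul_nonneg (h0 _) ((isLocalMetric (E := E) p).density_pos hy).le

/-- A nonnegative integrand with zero integral vanishes almost everywhere, and by continuity
everywhere on the open chart domain; the density is positive and can be divided out. -/
lemma eq_zero_of_chartIntegral_eq_zero {p : M} {h : M → ℝ} (h0 : ∀ x, 0 ≤ h x) (hc : Continuous h)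
    (hs : tsupport h ⊆ (extChartAt 𝓘(ℝ, E) p).source) (hi : chartIntegral μ p h = 0) (x : M) :
    h x = 0 := by
  by_cases hx : x ∈ (extChartAt 𝓘(ℝ, E) p).source
  · obtain ⟨y, hy, rfl⟩ := exists_eq_param hx
    have hpos {y : E} (hy : y ∈ dom E p) : 0 < density (locMetric p) y :=
      (isLocalMetric (E := E) p).density_pos hy
    have hnn : 0 ≤ᵐ[μ.restrict (dom E p)] fun y ↦ h (param E p y) * density (locMetric p) y :=
      ae_restrict_of_forall_mem (isOpen_dom p).measurableSet fun _ hy ↦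
        mul_nonneg (h0 _) (hpos hy).le
    have h1 := (setIntegral_eq_zero_iff_of_nonneg_ae hnn (integrableOn_chart μ hc hs)).1 hi
    have h2 := Measure.eqOn_open_of_ae_eq h1 (isOpen_dom p) (continuousOn_integrand hc)
      continuousOn_const hy
    exact (mul_eq_zero.1 h2).resolve_right (hpos hy).ne'
  · exact image_eq_zero_of_notMem_tsupport fun h ↦ hx (hs h)

lemma chartIntegral_divergence (hX : IsSmoothField X) {f : M → ℝ} (hf : IsSmoothFun E f) {p : M}
    (hs : tsupport f ⊆ (extChartAt 𝓘(ℝ, E) p).source) :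
    chartIntegral μ p (divergence fun x ↦ f x • X x) = 0 := by
  have hZ := hX.smul hf
  have h1 := (isLocalMetric (E := E) p).setIntegral_localDiv μ ((hZ p).of_le (by simp))
    (isCompact_image_tsupport hs) (image_tsupport_subset hs) (fun y hy hyK ↦ by
      have h0 : (f ∘ param E p) y = 0 :=
        image_eq_zero_of_notMem_tsupport (f := f) (param_notMem_tsupport hy hyK)
      simp only [locField_smul, h0, zero_smul])
  rw [← h1]
  exact setIntegral_congr_fun (isOpen_dom p).measurableSet fun y hy ↦ by
    simp only [divergence_param hZ hy]

end

lemma divergence_smul_eq_zero (hX : IsSmoothField X) {f : M → ℝ} (hf : IsSmoothFun E f) {x : M}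
    (hx : x ∉ tsupport f) : divergence (fun x ↦ f x • X x) x = 0 := by
  have hy := mem_dom_self (E := E) x
  set y := extChartAt 𝓘(ℝ, E) x x with hydef
  have hp : param E x y = x := param_self x
  have hev : f ∘ param E x =ᶠ[𝓝 y] fun _ ↦ 0 := by
    have h1 : (tsupport f)ᶜ ∈ 𝓝 (param E x y) := by
      rw [hp]
      exact (isClosed_tsupport f).isOpen_compl.mem_nhds hx
    filter_upwards [(contMDiffAt_param hy).continuousAt.preimage_mem_nhds h1] with z hz
    exact image_eq_zero_of_notMem_tsupport (f := f) hz
  have h := divergence_smul_param hf hX hy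
  rw [hev.fderiv_eq, hp, image_eq_zero_of_notMem_tsupport hx] at h
  simpa using h

/-- On a closed manifold, a divergence which is nowhere negative vanishes. -/
theorem divergence_eq_zero_of_nonneg (hX : IsSmoothField X) (hnn : ∀ x, 0 ≤ divergence X x)
    (x : M) : divergence X x = 0 := by
  let _ : MeasurableSpace E := borel E
  have : BorelSpace E := ⟨rfl⟩
  let μ : Measure E := Measure.addHaar
  obtain ⟨f, hf⟩ := SmoothPartitionOfUnity.exists_isSubordinate_chartAt_source 𝓘(ℝ, E) M
  have hfs (i : M) : tsupport (f i) ⊆ (extChartAt 𝓘(ℝ, E) i).source := by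
    rw [extChartAt_source]
    exact hf i
  have hfin := f.locallyFinite.finite_nonempty_of_compact
  let s := hfin.toFinset
  have hsum (x : M) : ∑ i ∈ s, f i x = 1 := by
    rw [← f.sum_eq_one (Set.mem_univ x), finsum_eq_sum_of_support_subset]
    intro i hi
    simp only [s, Set.Finite.coe_toFinset, Set.mem_ofPred_eq]
    exact ⟨x, hi⟩
  have hsm (i : M) : IsSmoothFun E (f i) := isSmoothFun_of_contMDiff (f i).contMDiff
  have hcf (i : M) : Continuous (f i) := (f i).contMDiff.continuous
  let D (k : M) : M → ℝ := divergence fun x ↦ f k x • X x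
  have hDc (k : M) : Continuous (D k) := (hX.smul (hsm k)).divergence.continuous
  have hDs (k : M) : tsupport (D k) ⊆ tsupport (f k) := by
    refine closure_minimal (fun x hx ↦ ?_) (isClosed_tsupport _)
    by_contra h
    exact hx (divergence_smul_eq_zero hX (hsm k) h)
  -- By the product rule the extra terms add up to the derivative of ∑ fₖ = 1, which is zero.
  have hD (x : M) : ∑ k ∈ s, D k x = divergence X x := by
    have hy := mem_dom_self (E := E) x
    set y := extChartAt 𝓘(ℝ, E) x x with hydef
    have hp : param E x y = x := param_self x
    have h1 (k : M) : D k x = f k x * divergence X x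
        + fderiv ℝ (f k ∘ param E x) y (locField x X y) := by
      have := divergence_smul_param (hsm k) hX hy
      rwa [hp] at this
    have h2 : ∑ k ∈ s, fderiv ℝ (f k ∘ param E x) y = 0 := by
      rw [← fderiv_fun_sum fun k _ ↦ (hsm k).differentiableAt hy]
      simp only [Function.comp_apply, hsum, fderiv_fun_const, Pi.zero_apply]
    simp only [h1, Finset.sum_add_distrib, ← Finset.sum_mul, hsum]
    rw [← sum_apply, h2]
    simp
  have hprod_c (p k : M) : Continuous fun x ↦ f p x * D k x := (hcf p).mul (hDc k)
  have hprod_l (p k : M) : tsupport (fun x ↦ f p x * D k x) ⊆ (extChartAt 𝓘(ℝ, E) p).source :=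
    (tsupport_mul_subset_left (f := f p) (g := D k)).trans (hfs p)
  have hprod_r (p k : M) : tsupport (fun x ↦ f p x * D k x) ⊆ (extChartAt 𝓘(ℝ, E) k).source :=
    (tsupport_mul_subset_right (f := f p) (g := D k)).trans ((hDs k).trans (hfs k))
  -- The left side stands for the integral of div X over M. Splitting div X = ∑ Dₖ gives functions
  -- fₚ Dₖ supported in both charts; moving each from chart p to chart k and summing over p leaves
  -- the integrals of div(fₖ X), which vanish.
  have htotal : ∑ p ∈ s, chartIntegral μ p (fun x ↦ f p x * divergence X x) = 0 := by
    calc ∑ p ∈ s, chartIntegral μ p (fun x ↦ f p x * divergence X x)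
        = ∑ p ∈ s, ∑ k ∈ s, chartIntegral μ p (fun x ↦ f p x * D k x) := by
          refine Finset.sum_congr rfl fun p _ ↦ ?_
          simp only [← hD, Finset.mul_sum]
          exact chartIntegral_sum μ s (fun k _ ↦ hprod_c p k) fun k _ ↦ hprod_l p k
      _ = ∑ p ∈ s, ∑ k ∈ s, chartIntegral μ k (fun x ↦ f p x * D k x) := by
          refine Finset.sum_congr rfl fun p _ ↦ Finset.sum_congr rfl fun k _ ↦ ?_
          exact chartIntegral_eq μ
            (fun x hx ↦ image_eq_zero_of_notMem_tsupport (f := fun x ↦ f p x * D k x)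
              fun h ↦ hx (hprod_l p k h))
            (fun x hx ↦ image_eq_zero_of_notMem_tsupport (f := fun x ↦ f p x * D k x)
              fun h ↦ hx (hprod_r p k h))
      _ = ∑ k ∈ s, chartIntegral μ k (D k) := by
          rw [Finset.sum_comm]
          refine Finset.sum_congr rfl fun k _ ↦ ?_
          rw [← chartIntegral_sum μ s (fun p _ ↦ hprod_c p k) fun p _ ↦ hprod_r p k]
          simp only [← Finset.sum_mul, hsum, one_mul]
      _ = 0 := Finset.sum_eq_zero fun k _ ↦ chartIntegral_divergence μ hX (hsm k) (hfs k)
  have hn (p x : M) : 0 ≤ f p x * divergence X x := mul_nonneg (f.nonneg p x) (hnn x)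
  have hzero := (Finset.sum_eq_zero_iff_of_nonneg fun p _ ↦ chartIntegral_nonneg μ (hn p)).1 htotal
  rw [← one_mul (divergence X x), ← hsum x, Finset.sum_mul]
  refine Finset.sum_eq_zero fun p hp ↦ ?_
  exact eq_zero_of_chartIntegral_eq_zero μ (hn p) ((hcf p).mul hX.divergence.continuous)
    ((tsupport_mul_subset_left (f := f p) (g := divergence X)).trans (hfs p)) (hzero p hp) x

end DivergenceTheorem

end RBSoliton

/-! ### Pointwise consequences of the soliton equation, and Schur's lemma. -/

namespace RBSoliton

noncomputable section Soliton

set_option maxSynthPendingDepth 3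
set_option linter.unusedSectionVars false

open scoped Topology
open VectorField

variable {E : Type*} [NormedAddCommGroup E] [NormedSpace ℝ E] [FiniteDimensional ℝ E]

section Local

variable {G : E → E →L[ℝ] E →L[ℝ] ℝ} {U : Set E} {y : E} {X Z : E → E} {c : ℝ}
  {ι : Type*} [Fintype ι] {e : ι → E}

lemma localDiv_congr (h : X =ᶠ[𝓝 y] Z) : localDiv G X y = localDiv G Z y := by
  rw [localDiv, localDiv, covDeriv, covDeriv, h.fderiv_eq, h.eq_of_nhds]

/-- The soliton equation in coordinates, at the point `y`. -/
def LocalSoliton (G : E → E →L[ℝ] E →L[ℝ] ℝ) (X : E → E) (c : ℝ) (y : E) : Prop :=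
  ∀ u v, localRicci G y u v + (1 / 2) * localLie G X y u v = c * G y u v

/-- The soliton equation writes Ric as a combination of the symmetric forms G and £_X G, so no pair
symmetry of the curvature is required. -/
lemma IsLocalMetric.ricciOp_symm (hG : IsLocalMetric G U) (hy : y ∈ U)
    (h : LocalSoliton G X c y) (u v : E) : G y (ricciOp G y u) v = G y u (ricciOp G y v) := by
  have h1 := h u v
  have h2 := h v u
  rw [hG.localLie_eq hy, hG.symm y hy u] at h1
  rw [hG.localLie_eq hy, hG.symm y hy v] at h2
  rw [hG.ricciOp_pairing hy, hG.symm y hy u, hG.ricciOp_pairing hy]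
  have h3 := hG.symm y hy u v
  linear_combination h1 - h2 + c * h3

/-- The trace of the soliton equation. -/
lemma IsLocalMetric.localScalar_add_localDiv (hG : IsLocalMetric G U) (hy : y ∈ U)
    (he : ∀ A : E →L[ℝ] E, tr A = ∑ i, G y (A (e i)) (e i)) (h : LocalSoliton G X c y) :
    localScalar G y + localDiv G X y = c * Module.finrank ℝ E := by
  have h1 : ∑ i, (localRicci G y (e i) (e i) + (1 / 2) * localLie G X y (e i) (e i))
      = ∑ i, c * G y (e i) (e i) := Finset.sum_congr rfl fun i _ ↦ h _ _
  rw [Finset.sum_add_distrib, ← Finset.mul_sum, ← Finset.mul_sum, hG.sum_localLie hy he] at h1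
  have h2 : tr (ContinuousLinearMap.id ℝ E) = ∑ i, G y (e i) (e i) := he _
  rw [← h2, tr_id] at h1
  rw [← h1, localScalar, he]
  simp only [hG.ricciOp_pairing hy]
  ring

lemma IsLocalMetric.tr_ricciOp_comp_covDeriv (hG : IsLocalMetric G U) (hy : y ∈ U)
    (he : ∀ A : E →L[ℝ] E, tr A = ∑ i, G y (A (e i)) (e i)) (h : LocalSoliton G X c y) :
    tr (ricciOp G y ∘L covDeriv G X y)
      = c * localScalar G y - tr (ricciOp G y ∘L ricciOp G y) := by
  set Q := ricciOp G y with hQ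
  -- The soliton equation says that c − Q is the symmetric part of ∇X, so B is the skew part; its
  -- product with the symmetric Q has trace zero.
  let B : E →L[ℝ] E := covDeriv G X y - (c • ContinuousLinearMap.id ℝ E - Q)
  have hB (u v : E) : G y (B u) v = - G y u (B v) := by
    have h1 := h u v
    have h2 := hG.ricciOp_symm hy h u v
    have h3 := hG.ricciOp_pairing hy u v
    rw [hG.localLie_eq hy] at h1
    simp only [B, sub_apply, smul_apply, ContinuousLinearMap.id_apply, map_sub, map_smul,
      smul_eq_mul]
    linear_combination 2 * h1 - h2 + 2 * h3
  have h1 : tr (Q ∘L B) = - tr (B ∘L Q) := by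
    rw [he, he, ← Finset.sum_neg_distrib]
    refine Finset.sum_congr rfl fun i _ ↦ ?_
    rw [ContinuousLinearMap.comp_apply, ContinuousLinearMap.comp_apply, hB, neg_neg,
      hG.ricciOp_symm hy h, hG.symm y hy]
  have h2 : tr (Q ∘L B) = 0 := by
    rw [tr_comp_comm B] at h1
    linarith
  simp only [B, ContinuousLinearMap.comp_sub, ContinuousLinearMap.comp_smul,
    ContinuousLinearMap.comp_id, map_sub, map_smul, smul_eq_mul] at h2
  rw [localScalar, ← hQ]
  linarith

/-- The divergence of `½ S X - Q X` for a divergence-free soliton field `X`. -/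
lemma IsLocalMetric.localDiv_einstein (hG : IsLocalMetric G U) (hy : y ∈ U)
    (he : ∀ A : E →L[ℝ] E, tr A = ∑ i, G y (A (e i)) (e i)) (h : LocalSoliton G X c y)
    (hX : DifferentiableAt ℝ X y) (h0 : localDiv G X y = 0) :
    localDiv G (fun z ↦ ((1 / 2) * localScalar G z) • X z - ricciOp G z (X z)) y
      = ∑ i, G y (ricciOp G y (e i) - c • e i) (ricciOp G y (e i) - c • e i) := by
  have hS := differentiableAt_of_contDiffOn hG.isOpen hy hG.contDiffOn_localScalar
  have hQ := differentiableAt_of_contDiffOn hG.isOpen hy hG.contDiffOn_ricciOp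
  have hS2 : DifferentiableAt ℝ (fun z ↦ (1 / 2) * localScalar G z) y := hS.const_mul _
  rw [localDiv_sub (X := fun z ↦ ((1 / 2) * localScalar G z) • X z) (hS2.smul hX)
      (hQ.clm_apply hX), localDiv_smul hS2 hX,
    hG.localDiv_ricciOp hy he hX, hG.tr_ricciOp_comp_covDeriv hy he h, h0,
    fderiv_const_mul hS]
  have ht := hG.localScalar_add_localDiv hy he h
  rw [h0, add_zero] at ht
  -- Summed over i this is tr Q² − 2cS + c²n, which equals tr Q² − cS because S = cn. On the other
  -- side the two terms ½ X(S) cancel.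
  have h1 (i : ι) : G y (ricciOp G y (e i) - c • e i) (ricciOp G y (e i) - c • e i)
      = G y ((ricciOp G y ∘L ricciOp G y) (e i)) (e i) - 2 * c * G y (ricciOp G y (e i)) (e i)
        + c ^ 2 * G y (ContinuousLinearMap.id ℝ E (e i)) (e i) := by
    simp only [map_sub, sub_apply, map_smul, smul_apply, smul_eq_mul,
      ContinuousLinearMap.comp_apply, ContinuousLinearMap.id_apply]
    rw [hG.ricciOp_symm hy h (ricciOp G y (e i)), hG.symm y hy (e i) (ricciOp G y (e i))]
    ring
  simp only [h1, Finset.sum_add_distrib, Finset.sum_sub_distrib, ← Finset.mul_sum, ← he, tr_id]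
  simp only [smul_apply, smul_eq_mul]
  change _ = _ - 2 * c * localScalar G y + _
  linear_combination c * ht

lemma IsLocalMetric.apply_self_nonneg (hG : IsLocalMetric G U) (hy : y ∈ U) (w : E) :
    0 ≤ G y w w := by
  by_cases hw : w = 0
  · simp [hw]
  · exact (hG.pos y hy w hw).le

/-- Positivity kills each P eᵢ. That the eᵢ span is not assumed: the trace formula applied to G(Pv,
·)v ∘ P gives G(Pv, Pv) = 0 instead. -/
lemma IsLocalMetric.eq_zero_of_frame (hG : IsLocalMetric G U) (hy : y ∈ U)
    (he : ∀ A : E →L[ℝ] E, tr A = ∑ i, G y (A (e i)) (e i)) {P : E →L[ℝ] E}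
    (hP : ∑ i, G y (P (e i)) (P (e i)) = 0) : P = 0 := by
  have hPe (i : ι) : P (e i) = 0 := by
    have h := (Finset.sum_eq_zero_iff_of_nonneg fun i _ ↦ hG.apply_self_nonneg hy (P (e i))).1 hP i (Finset.mem_univ i)
    by_contra hne
    exact (hG.pos y hy _ hne).ne' h
  ext v
  have h1 : tr (((G y (P v)).smulRight v) ∘L P) = 0 := by
    rw [he]
    refine Finset.sum_eq_zero fun i _ ↦ ?_
    rw [ContinuousLinearMap.comp_apply, hPe, map_zero, map_zero, zero_apply]
  rw [tr_comp_comm, tr_apply] at h1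
  have h2 : G y (P v) (P v) = 0 := by
    have h3 : P ∘L (G y (P v)).smulRight v = (G y (P v)).smulRight (P v) := by
      ext; simp
    rw [h3] at h1
    exact (LinearMap.trace_smulRight (G y (P v) : E →ₗ[ℝ] ℝ) (P v)).symm.trans h1
  by_contra hne
  exact (hG.pos y hy _ hne).ne' h2

/-- Schur's lemma in coordinates. -/
lemma IsLocalMetric.fderiv_localScalar_eq_zero (hG : IsLocalMetric G U) (hy : y ∈ U)
    (he : ∀ A : E →L[ℝ] E, tr A = ∑ i, G y (A (e i)) (e i)) (hn : 2 < Module.finrank ℝ E)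
    (hQ : ∀ z ∈ U, ricciOp G z
      = (localScalar G z / Module.finrank ℝ E) • ContinuousLinearMap.id ℝ E) :
    fderiv ℝ (localScalar G) y = 0 := by
  ext u
  have hS := differentiableAt_of_contDiffOn hG.isOpen hy hG.contDiffOn_localScalar
  have hn' : (2 : ℝ) < Module.finrank ℝ E := by exact_mod_cast hn
  have hev : (fun z ↦ ricciOp G z u) =ᶠ[𝓝 y] fun z ↦ (localScalar G z / Module.finrank ℝ E) • u := by
    filter_upwards [hG.mem_nhds hy] with z hz
    rw [hQ z hz]
    rfl
  have hSd : DifferentiableAt ℝ (fun z ↦ localScalar G z / Module.finrank ℝ E) y := by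
    simp only [div_eq_mul_inv]
    exact hS.mul_const _
  -- For the constant field u and Q = (S/n) id, the terms with div u cancel and u(S)/n = u(S)/2
  -- remains, which forces u(S) = 0 when n ≠ 2.
  have h1 := hG.localDiv_ricciOp hy he (differentiableAt_const (𝕜 := ℝ) u)
  rw [localDiv_congr hev, localDiv_smul (f := fun z ↦ localScalar G z / Module.finrank ℝ E) (X := fun _ ↦ u)
    hSd (differentiableAt_const u), hQ y hy] at h1
  have h2 : fderiv ℝ (fun z ↦ localScalar G z / Module.finrank ℝ E) y u
      = fderiv ℝ (localScalar G) y u / Module.finrank ℝ E := by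
    simp only [div_eq_mul_inv]
    rw [fderiv_mul_const hS, smul_apply, smul_eq_mul, mul_comm]
  simp only [ContinuousLinearMap.smul_comp, ContinuousLinearMap.id_comp, map_smul, smul_eq_mul, h2]
    at h1
  rw [localDiv] at h1
  have h3 : fderiv ℝ (localScalar G) y u * (Module.finrank ℝ E - 2) = 0 := by
    field_simp at h1
    linear_combination -h1
  exact (mul_eq_zero.1 h3).resolve_right (by linarith)

end Local

variable {M : Type*} [TopologicalSpace M] [ChartedSpace E M]
  [IsManifold 𝓘(ℝ, E) ∞ M]
  {ξ : Π x : M, TangentSpace 𝓘(ℝ, E) x} {f : M → ℝ} {p : M} {y : E}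

/-- A function which is constant along the integral curves of `ξ` is annihilated by `ξ`. -/
lemma fderiv_eq_zero_of_constant_along (hξ : ContMDiff 𝓘(ℝ, E) 𝓘(ℝ, E).tangent ∞
      (fun x ↦ (⟨x, ξ x⟩ : TangentBundle 𝓘(ℝ, E) M)))
    (hf : IsSmoothFun E f) (hc : IsConstantAlongIntegralCurves ξ f) (hy : y ∈ dom E p) :
    fderiv ℝ (f ∘ param E p) y (locField p ξ y) = 0 := by
  have : CompleteSpace E := FiniteDimensional.complete ℝ E
  have : IsManifold 𝓘(ℝ, E) 1 M := IsManifold.of_le (n := ∞) (by simp)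
  obtain ⟨γ, h0, hγ⟩ := exists_isMIntegralCurveAt_of_contMDiffAt_boundaryless (I := 𝓘(ℝ, E)) 0
    ((hξ (param E p y)).of_le (by simp))
  obtain ⟨ε, hε, hγε⟩ := isMIntegralCurveAt_iff'.1 hγ
  rw [Real.ball_eq_Ioo] at hγε
  have hev : f ∘ γ =ᶠ[𝓝 0] fun _ ↦ f (γ 0) := by
    filter_upwards [Ioo_mem_nhds (a := 0 - ε) (b := 0 + ε) (x := (0 : ℝ)) (by simpa) (by simpa)]
      with t ht
    exact hc γ _ _ hγε t ht 0 ⟨by simpa, by simpa⟩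
  have hfm := mdifferentiableAt_of_comp_param hy (hf.differentiableAt hy)
  rw [← mvfderiv_param hy (hf.differentiableAt hy) ξ]
  rw [← h0] at hfm ⊢
  -- f ∘ γ is constant near 0, so the chain rule turns its zero derivative into df(ξ) = 0 at γ(0).
  have hcomp := (hfm.hasMFDerivAt.comp 0 hγ.hasMFDerivAt).mfderiv
  rw [hev.mfderiv_eq, mfderiv_const] at hcomp
  have h1 := congrArg (fun A : ℝ →L[ℝ] ℝ ↦ A 1) hcomp
  have h2 : mfderiv 𝓘(ℝ, E) 𝓘(ℝ, ℝ) f (γ 0) (((1 : ℝ →L[ℝ] ℝ).smulRight (ξ (γ 0))) (1 : ℝ)) = 0 :=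
    h1.symm
  rw [ContinuousLinearMap.smulRight_apply, one_apply_eq_self, one_smul] at h2
  exact h2

end Soliton

end RBSoliton

/-! ### Vanishing divergence, the Einstein condition and the theorem. -/

namespace RBSoliton

noncomputable section Main

set_option maxSynthPendingDepth 3
set_option linter.unusedSectionVars false

open scoped Topology

variable {E : Type*} [NormedAddCommGroup E] [NormedSpace ℝ E] [FiniteDimensional ℝ E]
  {M : Type*} [TopologicalSpace M] [ChartedSpace E M] [IsManifold 𝓘(ℝ, E) ∞ M]
  {f : M → ℝ} {p : M} {y : E}

variable (E) in
lemma exists_param_eq (x : M) : ∃ p : M, ∃ y ∈ dom E p, param E p y = x :=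
  ⟨x, _, mem_dom_self x, param_self x⟩

/-- Each point has a neighbourhood that the chart maps into a ball inside its target, and a ball is
connected. -/
lemma isLocallyConstant_of_fderiv_eq_zero (hf : IsSmoothFun E f)
    (h : ∀ p, ∀ y ∈ dom E p, fderiv ℝ (f ∘ param E p) y = 0) : IsLocallyConstant f := by
  rw [IsLocallyConstant.iff_eventually_eq]
  intro x
  obtain ⟨r, hr, hB⟩ := Metric.mem_nhds_iff.1 (dom_mem_nhds (mem_dom_self (E := E) x))
  have hc {z : E} (hz : z ∈ Metric.ball (extChartAt 𝓘(ℝ, E) x x) r) :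
      f (param E x z) = f x := by
    have h1 := Metric.isOpen_ball.is_const_of_fderiv_eq_zero (𝕜 := ℝ)
      (convex_ball (extChartAt 𝓘(ℝ, E) x x) r).isPreconnected
      (fun z hz ↦ (hf.differentiableAt (hB hz)).differentiableWithinAt)
      (fun z hz ↦ h x z (hB hz)) hz (Metric.mem_ball_self hr)
    rwa [Function.comp_apply, Function.comp_apply, param_self] at h1
  filter_upwards [extChartAt_source_mem_nhds (I := 𝓘(ℝ, E)) x,
    (continuousAt_extChartAt (I := 𝓘(ℝ, E)) x).preimage_mem_nhds (Metric.ball_mem_nhds _ hr)]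
    with z hz hzB
  rw [← hc hzB]
  exact congrArg f ((extChartAt 𝓘(ℝ, E) x).left_inv hz).symm

variable [RiemannianBundle (fun x : M ↦ TangentSpace 𝓘(ℝ, E) x)]
  [IsContMDiffRiemannianBundle 𝓘(ℝ, E) ∞ E (fun x : M ↦ TangentSpace 𝓘(ℝ, E) x)]
  {ξ : Π x : M, TangentSpace 𝓘(ℝ, E) x} {lam : M → ℝ} {ρ : ℝ}

variable (M) in
lemma isSmoothFun_scalarCurvature : IsSmoothFun E (scalarCurvature E : M → ℝ) := fun p ↦
  (isLocalMetric (E := E) p).contDiffOn_localScalar.congr fun _ hy ↦ scalarCurvature_param hy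

/-- The vector field `½ S ξ - Q ξ`, where `Q` is the Ricci operator. -/
def einsteinField (ξ : Π x : M, TangentSpace 𝓘(ℝ, E) x) (x : M) : TangentSpace 𝓘(ℝ, E) x :=
  ((1 / 2) * scalarCurvature E x) • ξ x
    - ∑ i, ricci x (ξ x) (orthoBasis (E := E) x i) • orthoBasis (E := E) x i

lemma locField_einsteinField (hy : y ∈ dom E p) :
    locField p (einsteinField ξ) y = ((1 / 2) * localScalar (locMetric p) y) • locField p ξ y
      - ricciOp (locMetric p) y (locField p ξ y) := by
  have h1 : dparam p y (ricciOp (locMetric p) y (locField p ξ y))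
      = ∑ i, ricci (param E p y) (ξ (param E p y)) (orthoBasis (E := E) (param E p y) i)
        • orthoBasis (E := E) (param E p y) i := by
    rw [← (orthoBasis (E := E) (param E p y)).sum_repr' (dparam p y _)]
    refine Finset.sum_congr rfl fun i _ ↦ ?_
    rw [← dparam_frame hy i, ← dparam_locField hy ξ, ricci_param hy,
      ← (isLocalMetric (E := E) p).ricciOp_pairing hy, locMetric_apply, real_inner_comm]
  rw [locField, einsteinField, ← h1, ← dparam_locField hy ξ, scalarCurvature_param hy, ← map_smul,
    ← map_sub, inverse_dparam_apply hy]

lemma isSmoothField_einsteinField (hξ : IsSmoothField ξ) : IsSmoothField (einsteinField ξ) :=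
  fun p ↦ by
    have hG := isLocalMetric (E := E) p
    exact (((contDiffOn_const.mul hG.contDiffOn_localScalar).smul (hξ p)).sub
      (hG.contDiffOn_ricciOp.clm_apply (hξ p))).congr fun y hy ↦ locField_einsteinField hy

namespace IsAlmostRBSoliton

variable (h : IsAlmostRBSoliton ξ lam ρ)
include h

lemma isSmoothField : IsSmoothField ξ := isSmoothField_of_contMDiff h.smooth_field

lemma localSoliton (hy : y ∈ dom E p) :
    LocalSoliton (locMetric p) (locField p ξ)
      (lam (param E p y) + ρ * scalarCurvature E (param E p y)) y := fun u v ↦ by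
  rw [← ricci_param hy, ← lieMetric_param hy (h.isSmoothField.contDiffAt_one hy)]
  exact h.soliton_eq _ _ _

/-- The trace of the soliton equation. -/
lemma divergence_eq : divergence ξ = fun x ↦
    (Module.finrank ℝ E : ℝ) * (lam x + ρ * scalarCurvature E x) - scalarCurvature E x := by
  ext x
  obtain ⟨p, y, hy, rfl⟩ := exists_param_eq E x
  have h1 := (isLocalMetric (E := E) p).localScalar_add_localDiv hy (tr_frame hy)
    (h.localSoliton hy)
  rw [← scalarCurvature_param hy, ← divergence_param h.isSmoothField hy] at h1
  linarith

variable [T2Space M] [CompactSpace M]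

/-- The field (div ξ) ξ has divergence (div ξ)² + ξ(div ξ), and the last term is zero by hypothesis;
a nonnegative divergence vanishes. -/
lemma divergence_eq_zero (hc : IsConstantAlongIntegralCurves ξ (divergence ξ)) (x : M) :
    divergence ξ x = 0 := by
  have hξ := h.isSmoothField
  have key (x : M) : divergence (fun x ↦ divergence ξ x • ξ x) x = divergence ξ x ^ 2 := by
    obtain ⟨p, y, hy, rfl⟩ := exists_param_eq E x
    rw [divergence_smul_param hξ.divergence hξ hy,
      fderiv_eq_zero_of_constant_along h.smooth_field hξ.divergence hc hy]
    ring
  have h1 := divergence_eq_zero_of_nonneg (hξ.smul hξ.divergence)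
    (fun x ↦ by rw [key]; positivity) x
  rw [key] at h1
  exact pow_eq_zero_iff two_ne_zero |>.1 h1

/-- A soliton on a closed manifold with divergence-free potential field is Einstein. -/
lemma ricciOp_eq (h0 : ∀ x, divergence ξ x = 0) (hy : y ∈ dom E p) :
    ricciOp (locMetric p) y = (lam (param E p y) + ρ * scalarCurvature E (param E p y))
      • ContinuousLinearMap.id ℝ E := by
  have hξ := h.isSmoothField
  have hW := isSmoothField_einsteinField hξ
  have key {p : M} {y : E} (hy : y ∈ dom E p) : divergence (einsteinField ξ) (param E p y)
      = ∑ i, locMetric p y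
        ((ricciOp (locMetric p) y - (lam (param E p y) + ρ * scalarCurvature E (param E p y))
          • ContinuousLinearMap.id ℝ E) (frame E p y i))
        ((ricciOp (locMetric p) y - (lam (param E p y) + ρ * scalarCurvature E (param E p y))
          • ContinuousLinearMap.id ℝ E) (frame E p y i)) := by
    have hev : locField p (einsteinField ξ) =ᶠ[𝓝 y] fun z ↦
        ((1 / 2) * localScalar (locMetric p) z) • locField p ξ z
          - ricciOp (locMetric p) z (locField p ξ z) := by
      filter_upwards [dom_mem_nhds hy] with z hz using locField_einsteinField hz
    rw [divergence_param hW hy, localDiv_congr hev]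
    exact (isLocalMetric (E := E) p).localDiv_einstein hy (tr_frame hy) (h.localSoliton hy)
      (hξ.differentiableAt hy) (by rw [← divergence_param hξ hy, h0])
  have hnn (x : M) : 0 ≤ divergence (einsteinField ξ) x := by
    obtain ⟨p, y, hy, rfl⟩ := exists_param_eq E x
    rw [key hy]
    exact Finset.sum_nonneg fun i _ ↦ (isLocalMetric (E := E) p).apply_self_nonneg hy _
  have h1 := divergence_eq_zero_of_nonneg hW hnn (param E p y)
  rw [key hy] at h1
  exact sub_eq_zero.1 ((isLocalMetric (E := E) p).eq_zero_of_frame hy (tr_frame hy) h1)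

lemma isKilling (h0 : ∀ x, divergence ξ x = 0) : IsKilling ξ := fun x u v ↦ by
  obtain ⟨p, y, hy, rfl⟩ := exists_param_eq E x
  have h1 := h.soliton_eq (param E p y) u v
  have h2 : ricci (param E p y) u v
      = (lam (param E p y) + ρ * scalarCurvature E (param E p y)) * inner ℝ u v := by
    rw [← dparam_inverse_apply hy u, ← dparam_inverse_apply hy v, ricci_param hy,
      ← (isLocalMetric (E := E) p).ricciOp_pairing hy, h.ricciOp_eq h0 hy]
    simp only [smul_apply, ContinuousLinearMap.id_apply, map_smul, smul_eq_mul, locMetric_apply]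
  linarith

/-- Schur's lemma for the soliton. -/
lemma exists_lam_eq [ConnectedSpace M] (hn : 2 < Module.finrank ℝ E)
    (h0 : ∀ x, divergence ξ x = 0) : ∃ c : ℝ, ∀ x, lam x = c := by
  have hn' : (Module.finrank ℝ E : ℝ) ≠ 0 := by positivity
  -- The trace identity with div ξ = 0. It brings Q = c into the form Q = S/n that Schur's lemma
  -- needs, and finally expresses λ through the constant S.
  have hc (x : M) : lam x + ρ * scalarCurvature E x = scalarCurvature E x / Module.finrank ℝ E := by
    have h1 := h0 x
    rw [h.divergence_eq] at h1
    field_simp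
    linarith
  have hS : IsLocallyConstant (scalarCurvature E : M → ℝ) := by
    refine isLocallyConstant_of_fderiv_eq_zero (isSmoothFun_scalarCurvature M) fun p y hy ↦ ?_
    have hev : (scalarCurvature E ∘ param E p) =ᶠ[𝓝 y] localScalar (locMetric p) := by
      filter_upwards [dom_mem_nhds hy] with z hz using scalarCurvature_param hz
    rw [hev.fderiv_eq]
    refine (isLocalMetric (E := E) p).fderiv_localScalar_eq_zero hy (tr_frame hy) hn fun z hz ↦ ?_
    rw [h.ricciOp_eq h0 hz, hc, scalarCurvature_param hz]
  obtain ⟨x₀⟩ := (inferInstance : Nonempty M)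
  refine ⟨lam x₀, fun x ↦ ?_⟩
  have h1 := hc x
  rw [hS.apply_eq_of_isPreconnected isPreconnected_univ (Set.mem_univ x) (Set.mem_univ x₀),
    ← hc x₀] at h1
  linarith

end IsAlmostRBSoliton

end Main

end RBSoliton

theorem theorem4p1 {n : ℕ} (hn : 2 < n)
    {E : Type*} [NormedAddCommGroup E] [NormedSpace ℝ E] [FiniteDimensional ℝ E]
    (hE : Module.finrank ℝ E = n)
    {M : Type*} [TopologicalSpace M] [T2Space M] [CompactSpace M] [ConnectedSpace M]
    [ChartedSpace E M] [IsManifold 𝓘(ℝ, E) ∞ M]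
    [RiemannianBundle (fun x : M ↦ TangentSpace 𝓘(ℝ, E) x)]
    [IsContMDiffRiemannianBundle 𝓘(ℝ, E) ∞ E (fun x : M ↦ TangentSpace 𝓘(ℝ, E) x)]
    (ξ : Π x : M, TangentSpace 𝓘(ℝ, E) x) (lam : M → ℝ) (ρ : ℝ)
    (h : RBSoliton.IsAlmostRBSoliton ξ lam ρ) :
    RBSoliton.IsTrivialRBSoliton ξ lam ρ ↔
      RBSoliton.IsConstantAlongIntegralCurves ξ
        (fun x ↦ (n : ℝ) * (lam x + ρ * RBSoliton.scalarCurvature E x)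
          - RBSoliton.scalarCurvature E x) := by
  subst hE
  rw [← h.divergence_eq]
  constructor
  · intro ht γ a b _ s _ t _
    -- The divergence is a trace of £_ξ g, so for a Killing field the function is identically zero.
    simp only [RBSoliton.divergence, ht.killing _, Finset.sum_const_zero, mul_zero]
  · intro hc
    have h0 := h.divergence_eq_zero hc
    exact { h with constant := h.exists_lam_eq hn h0, killing := h.isKilling h0 }
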